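/- Let $F$ be a number field and let $S=\{\mathfrak p_1,\dots,\mathfrak p_r\}$ be a finite set of $r$ distinct nonzero primes of $\mathcal O_F$. For $\mathfrak p\in S$ let $\mathscr T_{\mathfrak p}$ be the Bruhat–Tits tree of $\mathrm{PGL}_2(F_{\mathfrak p})$: its vertices are the homothety classes of $\mathcal O_{F,\mathfrak p}$-lattices in $F_{\mathfrak p}\oplus F_{\mathfrak p}$, and there is one oriented edge $e$ with source $s(e)=v_1$ and target $v_2$ whenever $v_1,v_2$ have representatives with $\mathfrak p\Lambda_2\subsetneq\Lambda_1\subsetneq\Lambda_2$; write $\overline e$ for the opposite edge. For $m\in\mathbb N$ let $\mathscr V_{\mathfrak p}^{\le m}$ be the set of vertices at distance at most $m$ from the class of $\mathcal O_{F,\mathfrak p}\oplus\mathcal O_{F,\mathfrak p}$, and $\mathscr E_{\mathfrak p}^{\le m}$ the set of oriented edges with both endpoints in $\mathscr V_{\mathfrak p}^{\le m}$. Let $\mathcal F_0(\mathscr E_{\mathfrak p}^{\le m},\mathbb Q)$ be the space of functions $c:\mathscr E_{\mathfrak p}^{\le m}\to\mathbb Q$ with $c(e)+c(\overline e)=0$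 for all $e$, and $\mathcal F(\mathscr V_{\mathfrak p}^{\le m},\mathbb Q)$ the space of all functions $\mathscr V_{\mathfrak p}^{\le m}\to\mathbb Q$. Let $C^\bullet_{\mathfrak p,m}(\mathbb Q)$ be the complex $$0\to\mathcal F_0(\mathscr E_{\mathfrak p}^{\le m+1},\mathbb Q)\xrightarrow{\ \varphi_{\mathfrak p}\ }\mathcal F(\mathscr V_{\mathfrak p}^{\le m},\mathbb Q)\to0,\qquad \varphi_{\mathfrak p}(c)(v)=\sum_{s(e)=v}c(e),$$ with the edge term in degree $1$ and the vertex term in degree $0$ (so the differential lowers the degree by one). Put $C^\bullet_{S,m}(\mathbb Q)=\bigotimes_{\mathfrak p\in S}C^\bullet_{\mathfrak p,m}(\mathbb Q)$ (tensor product of chain complexes of $\mathbb Q$-vector spaces) and $C^\bullet_{S,\infty}(\mathbb Q)=\varprojlim_m C^\bullet_{S,m}(\mathbb Q)$, with transition maps given by restriction of functions. Then: 1. The cohomology of $C^\bullet_{S,\infty}(\mathbb Q)$ is concentrated in the top degree $|S|=r$: $\mathrm H^i\big(C^\bullet_{S,\infty}(\mathbb Q)\big)=0$ for all $i\ne r$.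 2. Evaluation on multiedges, which sends $\bigotimes_j c_j$ to the function $(e_j)_j\mapsto\prod_j c_j(e_j)$, identifies $\mathrm H^{r}\big(C^\bullet_{S,\infty}(\mathbb Q)\big)$ with the space $\mathrm{HC}_S(\mathbb Q)$ of $S$-harmonic cochains, that is, the functions $c:\prod_{j=1}^r\mathscr E_{\mathfrak p_j}\to\mathbb Q$, where $\mathscr E_{\mathfrak p_j}$ is the set of all oriented edges of $\mathscr T_{\mathfrak p_j}$, such that for every $j$ and every multiedge $e=(e_1,\dots,e_r)$ $$c(e_1,\dots,\overline{e_j},\dots,e_r)=-c(e_1,\dots,e_j,\dots,e_r)\quad\text{and}\quad \sum_{s(e')=v}c(e_1,\dots,e',\dots,e_r)=0\ \text{ for every vertex } v \text{ of } \mathscr T_{\mathfrak p_j},$$ where in both formulas only the $j$-th component is changed. -/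

import Mathlib

set_option linter.unusedSectionVars false
open CategoryTheory CategoryTheory.Limits IsDedekindDomain NumberField TensorProduct
open scoped Pointwise

noncomputable section

universe u

namespace BruhatTits

section Tree

variable (O K : Type*) [CommRing O] [IsDomain O] [IsDiscreteValuationRing O]
  [Field K] [Algebra O K] [IsFractionRing O K]

/-- The `O`-lattices in `K ⊕ K`. -/
abbrev Lat : Type _ := {Λ : Submodule O (Fin 2 → K) // Λ.IsLattice K}

/-- Homothety of lattices. -/
def homothety : Setoid (Lat O K) where
  r Λ Λ' := ∃ c : Kˣ, c • Λ.1 = Λ'.1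
  iseqv :=
    { refl := fun Λ => ⟨1, one_smul _ _⟩
      symm := by
        rintro Λ Λ' ⟨c, hc⟩
        exact ⟨c⁻¹, by rw [← hc, inv_smul_smul]⟩
      trans := by
        rintro Λ Λ' Λ'' ⟨c, hc⟩ ⟨d, hd⟩
        exact ⟨d * c, by rw [mul_smul, hc, hd]⟩ }

/-- The vertices of the Bruhat-Tits tree: homothety classes of lattices. -/
def Vertex : Type _ := Quotient (homothety O K)

variable {O K}

/-- The homothety class of a lattice. -/
def Lat.cls (Λ : Lat O K) : Vertex O K := Quotient.mk (homothety O K) Λ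

/-- `v` and `w` are joined by an edge with source `v` and target `w` if they have representatives
with `𝔭 Λ₂ ⊊ Λ₁ ⊊ Λ₂`, where `𝔭` is the maximal ideal of `O`. -/
def Vertex.Adj (v w : Vertex O K) : Prop :=
  ∃ Λ₁ Λ₂ : Lat O K, Λ₁.cls = v ∧ Λ₂.cls = w ∧
    IsLocalRing.maximalIdeal O • Λ₂.1 < Λ₁.1 ∧ Λ₁.1 < Λ₂.1

lemma Lat.cls_eq_iff {Λ Λ' : Lat O K} : Λ.cls = Λ'.cls ↔ ∃ c : Kˣ, c • Λ.1 = Λ'.1 :=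
  Quotient.eq (r := homothety O K)

lemma smul_eq_of_maximalIdeal (O K : Type*) [CommRing O] [IsDomain O] [IsDiscreteValuationRing O]
    [Field K] [Algebra O K] [IsFractionRing O K] :
    ∃ c : Kˣ, ∀ Λ : Submodule O (Fin 2 → K), IsLocalRing.maximalIdeal O • Λ = c • Λ := by
  obtain ⟨ϖ, hϖ⟩ := IsDiscreteValuationRing.exists_irreducible O
  have h0 : algebraMap O K ϖ ≠ 0 := by
    simpa using hϖ.ne_zero
  refine ⟨Units.mk0 _ h0, fun Λ => ?_⟩
  rw [hϖ.maximalIdeal_eq, Submodule.ideal_span_singleton_smul]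
  ext x
  constructor
  · rintro ⟨y, hy, rfl⟩
    exact ⟨y, hy, by ext i; simp [Algebra.smul_def]⟩
  · rintro ⟨y, hy, rfl⟩
    exact ⟨y, hy, by ext i; simp [Algebra.smul_def]⟩

lemma units_smul_lt {c : Kˣ} {M N : Submodule O (Fin 2 → K)} : c • M < c • N ↔ M < N := by
  have h : ∀ {d : Kˣ} {M N : Submodule O (Fin 2 → K)}, M ≤ N → d • M ≤ d • N :=
    fun hMN => Submodule.map_mono hMN
  have h' : ∀ {M N : Submodule O (Fin 2 → K)}, c • M ≤ c • N ↔ M ≤ N := fun {M N} =>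
    ⟨fun hMN => by simpa using h (d := c⁻¹) hMN, h⟩
  rw [lt_iff_le_not_ge, lt_iff_le_not_ge, h', h']

lemma Vertex.Adj.symm {v w : Vertex O K} (h : v.Adj w) : w.Adj v := by
  obtain ⟨c, hc⟩ := smul_eq_of_maximalIdeal O K
  obtain ⟨Λ₁, Λ₂, rfl, rfl, h1, h2⟩ := h
  have := Λ₂.2
  refine ⟨⟨c • Λ₂.1, inferInstance⟩, Λ₁, ?_, rfl, ?_, ?_⟩
  · exact Lat.cls_eq_iff.2 ⟨c⁻¹, by simp⟩
  · change _ < c • Λ₂.1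
    rw [hc]
    exact units_smul_lt.2 h2
  · change c • Λ₂.1 < _
    rwa [← hc]

lemma smul_le_of_integral {a : O} {c : Kˣ} (h : algebraMap O K a = c)
    (Λ : Submodule O (Fin 2 → K)) : c • Λ ≤ Λ := by
  rintro _ ⟨y, hy, rfl⟩
  have : c • y = a • y := by
    ext i; simp [Units.smul_def, ← h, Algebra.smul_def]
  change c • y ∈ Λ
  rw [this]
  exact Λ.smul_mem a hy

lemma Vertex.Adj.ne {v w : Vertex O K} (h : v.Adj w) : v ≠ w := by
  obtain ⟨Λ₁, Λ₂, rfl, rfl, h1, h2⟩ := h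
  intro heq
  obtain ⟨c, hc⟩ := Lat.cls_eq_iff.1 heq.symm
  rw [← hc] at h1 h2
  rcases ValuationRing.isInteger_or_isInteger O (c : K) with ⟨a, ha⟩ | ⟨a, ha⟩
  · by_cases hu : IsUnit a
    · obtain ⟨u, rfl⟩ := hu
      have hi : algebraMap O K (u⁻¹ : Oˣ) = (c⁻¹ : Kˣ) := by
        rw [Units.val_inv_eq_inv_val, ← ha, map_units_inv]
      have := smul_le_of_integral hi (c • Λ₂.1)
      rw [inv_smul_smul] at this
      exact absurd h2 this.not_gt
    · refine absurd h1 (not_lt_of_ge ?_)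
      rintro _ ⟨y, hy, rfl⟩
      have : c • y = a • y := by
        ext i; simp [Units.smul_def, ← ha, Algebra.smul_def]
      change c • y ∈ _
      rw [this]
      exact Submodule.smul_mem_smul ((IsLocalRing.mem_maximalIdeal a).2 hu) hy
  · have hi : algebraMap O K a = (c⁻¹ : Kˣ) := by
      rw [ha, Units.val_inv_eq_inv_val]
    have := smul_le_of_integral hi (c • Λ₂.1)
    rw [inv_smul_smul] at this
    exact absurd h2 this.not_gt

variable (O K)

/-- The Bruhat-Tits tree of `PGL₂(K)`. Its oriented edges are the darts of this graph. -/
def tree : SimpleGraph (Vertex O K) where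
  Adj := Vertex.Adj
  symm := ⟨fun _ _ h => h.symm⟩
  loopless := ⟨fun _ h => h.ne rfl⟩

/-- Oriented edges of the Bruhat-Tits tree. The source, target and opposite of `e` are `e.fst`,
`e.snd` and `e.symm`. -/
abbrev Edge : Type _ := (tree O K).Dart

instance isLattice_std : (Submodule.span O (Set.range (Pi.basisFun K (Fin 2)))).IsLattice K where
  fg := Submodule.fg_span (Set.finite_range _)
  span_eq_top := by
    rw [Submodule.span_span_of_tower, (Pi.basisFun K (Fin 2)).span_eq]

/-- The vertex of the standard lattice `O ⊕ O`. -/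
def base : Vertex O K := Lat.cls ⟨Submodule.span O (Set.range (Pi.basisFun K (Fin 2))), inferInstance⟩

variable {O K}

/-- The tree is locally finite if the residue field is finite. -/
instance finite_edges [Finite (IsLocalRing.ResidueField O)] (v : Vertex O K) :
    Finite {e : Edge O K // e.fst = v} := by
  obtain ⟨Λ, rfl⟩ : ∃ Λ : Lat O K, Λ.cls = v := Quotient.exists_rep v
  have hΛ := Λ.2
  have : Finite (O ⧸ IsLocalRing.maximalIdeal O) :=
    inferInstanceAs (Finite (IsLocalRing.ResidueField O))
  have hq : Finite (Λ.1 ⧸ (IsLocalRing.maximalIdeal O • (⊤ : Submodule O Λ.1))) := by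
    have : Finite (Λ.1 ⧸ (⊤ : Submodule O Λ.1)) := inferInstance
    exact Submodule.finite_quotient_smul _ (Module.Finite.fg_top)
  have hfin : Finite (Submodule O (Λ.1 ⧸ (IsLocalRing.maximalIdeal O • (⊤ : Submodule O Λ.1)))) :=
    Finite.of_injective (β := Set (Λ.1 ⧸ (IsLocalRing.maximalIdeal O • (⊤ : Submodule O Λ.1))))
      (fun N => (N : Set _)) SetLike.coe_injective
  have key : ∀ e : {e : Edge O K // e.fst = Λ.cls}, ∃ N : Lat O K, N.cls = e.1.snd ∧
      IsLocalRing.maximalIdeal O • Λ.1 ≤ N.1 ∧ N.1 ≤ Λ.1 := by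
    rintro ⟨e, he⟩
    obtain ⟨Λ₁, Λ₂, h1, h2, h3, h4⟩ := Vertex.Adj.symm e.adj
    obtain ⟨c, hc⟩ := Lat.cls_eq_iff.1 (h2.trans he)
    obtain ⟨d, hd⟩ := smul_eq_of_maximalIdeal O K
    have := Λ₁.2
    refine ⟨⟨c • Λ₁.1, inferInstance⟩, ?_, ?_, ?_⟩
    · rw [← h1]
      exact Lat.cls_eq_iff.2 ⟨c⁻¹, by simp⟩
    · change _ ≤ c • Λ₁.1
      rw [← hc, hd, smul_comm, ← hd]
      exact (units_smul_lt.2 h3).le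
    · rw [← hc]
      exact (units_smul_lt.2 h4).le
  choose N hN1 hN2 hN3 using key
  refine Finite.of_injective (fun e => (((N e).1.comap Λ.1.subtype).map
    (IsLocalRing.maximalIdeal O • (⊤ : Submodule O Λ.1)).mkQ)) ?_
  intro e f hef
  have h1 : ∀ e, IsLocalRing.maximalIdeal O • (⊤ : Submodule O Λ.1) ≤
      (N e).1.comap Λ.1.subtype := by
    intro e
    rw [← Submodule.map_le_iff_le_comap, Submodule.map_smul'', Submodule.map_top,
      Submodule.range_subtype]
    exact hN2 e
  have h2 := congrArg (Submodule.comap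
    (IsLocalRing.maximalIdeal O • (⊤ : Submodule O Λ.1)).mkQ) hef
  simp only [Submodule.comap_map_mkQ, sup_eq_right.2 (h1 _)] at h2
  have h3 := congrArg (Submodule.map Λ.1.subtype) h2
  simp only [Submodule.map_comap_subtype, inf_eq_right.2 (hN3 _)] at h3
  have h4 : e.1.snd = f.1.snd := by
    rw [← hN1, ← hN1, Subtype.ext h3]
  exact Subtype.ext (SimpleGraph.Dart.ext _ _ (Prod.ext (e.2.trans f.2.symm) h4))

end Tree


/-- The completion of a number field at a finite prime has finite residue field. -/
instance finite_residueField {F : Type*} [Field F] [NumberField F] (v : HeightOneSpectrum (𝓞 F)) :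
    Finite (IsLocalRing.ResidueField (v.adicCompletionIntegers F)) := by
  have hfin : Finite (𝓞 F ⧸ v.asIdeal) := v.asIdeal.finiteQuotientOfFreeOfNeBot v.ne_bot
  let f : 𝓞 F →+* IsLocalRing.ResidueField (v.adicCompletionIntegers F) :=
    (IsLocalRing.residue _).comp (algebraMap (𝓞 F) (v.adicCompletionIntegers F))
  have hmem : ∀ x : v.adicCompletionIntegers F, IsLocalRing.residue _ x = 0 ↔
      Valued.v (x : v.adicCompletion F) < 1 := by
    intro x
    rw [IsLocalRing.residue_eq_zero_iff, IsLocalRing.mem_maximalIdeal, mem_nonunits_iff,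
      HeightOneSpectrum.adicCompletionIntegers.isUnit_iff_valued_eq_one]
    have : Valued.v (x : v.adicCompletion F) ≤ 1 := x.2
    exact ⟨fun h => lt_of_le_of_ne this h, fun h => h.ne⟩
  have hker : ∀ a ∈ v.asIdeal, f a = 0 := by
    intro a ha
    refine (hmem _).2 ?_
    rw [HeightOneSpectrum.algebraMap_adicCompletionIntegers_apply,
      HeightOneSpectrum.valuedAdicCompletion_eq_valuation']
    exact (HeightOneSpectrum.valuation_lt_one_iff_mem v a).2 ha
  refine Finite.of_surjective (Ideal.Quotient.lift v.asIdeal f hker)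
    (Ideal.Quotient.lift_surjective_of_surjective _ hker ?_)
  intro y
  obtain ⟨x, rfl⟩ := IsLocalRing.residue_surjective y
  obtain ⟨k, hk⟩ : ∃ k : F, Valued.v ((k : v.adicCompletion F) - x) < 1 := by
    have hopen : IsOpen {z : v.adicCompletion F | Valued.v (z - x) < 1} := by
      have h1 : IsOpen {z : v.adicCompletion F | Valued.v z < 1} := by
        simpa [Valuation.restrict_lt_one_iff] using Valued.isOpen_ball (v.adicCompletion F) 1
      exact h1.preimage (continuous_id.sub continuous_const)
    obtain ⟨k, hk⟩ := (HeightOneSpectrum.denseRange_algebraMap F v).exists_mem_open hopen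
      ⟨x, by simp⟩
    refine ⟨k, ?_⟩
    rwa [HeightOneSpectrum.algebraMap_adicCompletion] at hk
  have hk1 : v.valuation F k ≤ 1 := by
    rw [← HeightOneSpectrum.valuedAdicCompletion_eq_valuation',
      show (k : v.adicCompletion F) = (k - x) + x by ring]
    exact (Valuation.map_add _ _ _).trans (max_le hk.le x.2)
  obtain ⟨a, ha⟩ := HeightOneSpectrum.exists_valuation_sub_lt_of_integer v hk1 1
  refine ⟨a, ?_⟩
  rw [← sub_eq_zero]
  change IsLocalRing.residue _ _ - IsLocalRing.residue _ _ = 0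
  rw [← map_sub, hmem]
  rw [← HeightOneSpectrum.valuedAdicCompletion_eq_valuation'] at ha
  have : (((algebraMap (𝓞 F) (v.adicCompletionIntegers F) a - x : v.adicCompletionIntegers F)) :
      v.adicCompletion F) = ((algebraMap (𝓞 F) F a - k : F) : v.adicCompletion F) +
        ((k : v.adicCompletion F) - x) := by
    push_cast
    rw [HeightOneSpectrum.algebraMap_adicCompletionIntegers_apply]
    have h2 : ((algebraMap (𝓞 F) F a - k : F) : v.adicCompletion F) =
      ((algebraMap (𝓞 F) F a : F) : v.adicCompletion F) - (k : v.adicCompletion F) := by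
      simpa [HeightOneSpectrum.algebraMap_adicCompletion] using
        map_sub (algebraMap F (v.adicCompletion F)) (algebraMap (𝓞 F) F a) k
    rw [h2]
    ring
  rw [this]
  exact (Valuation.map_add _ _ _).trans_lt (max_lt (by simpa using ha) hk)

section Tensor

variable {r : ℕ} (K L : Fin r → ChainComplex (ModuleCat.{u} ℚ) ℕ)

/-- The identity of `C.X i` if `i = j`, and zero otherwise. -/
def idOrZero (C : ChainComplex (ModuleCat.{u} ℚ) ℕ) (i j : ℕ) : C.X i ⟶ C.X j :=
  if h : i = j then eqToHom (congrArg C.X h) else 0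

/-- The multidegrees of total degree `n`. -/
abbrev MultiDeg (r n : ℕ) : Type := {a : Fin r → ℕ // ∑ j, a j = n}

/-- Raise the `p`-th entry of a multidegree by one. -/
def MultiDeg.succ {n n' : ℕ} (h : n' + 1 = n) (a : MultiDeg r n') (p : Fin r) : MultiDeg r n :=
  ⟨a.1 + Pi.single p 1, by simp [Finset.sum_add_distrib, a.2, h]⟩

/-- Degree `n` of the tensor product of the complexes `K j`: the direct sum, over the finitely many
multidegrees `a` with `∑ j, a j = n`, of the spaces `⨂ j, (K j)_{a j}`. -/
abbrev tensorX (n : ℕ) : Type u := (a : MultiDeg r n) → ⨂[ℚ] j, (K j).X (a.1 j)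

/-- The `q`-th tensor factor of the `p`-th partial differential: it is the differential of `K p` if
`q = p` and the identity of `K q` if `q ≠ p`. -/
def partialFactor (p q : Fin r) (i j : ℕ) : (K q).X i ⟶ (K q).X j :=
  if q = p then (K q).d i j else idOrZero (K q) i j

/-- The differential of the tensor product, with the Koszul signs:
`d (x₁ ⊗ ⋯ ⊗ x_r) = ∑ p, (-1) ^ (deg x₁ + ⋯ + deg x_{p-1}) x₁ ⊗ ⋯ ⊗ d x_p ⊗ ⋯ ⊗ x_r`.
The component of multidegree `a` of the result comes from the components of multidegree
`a + e_p`. -/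
def tensorD {n n' : ℕ} (h : n' + 1 = n) : tensorX K n →ₗ[ℚ] tensorX K n' :=
  LinearMap.pi fun a => ∑ p : Fin r, (-1 : ℚ) ^ (∑ q with q < p, a.1 q) •
    (PiTensorProduct.map fun q => (partialFactor K p q ((a.succ h p).1 q) (a.1 q)).hom) ∘ₗ
      LinearMap.proj (a.succ h p)

lemma idOrZero_self (C : ChainComplex (ModuleCat.{u} ℚ) ℕ) (i : ℕ) : idOrZero C i i = 𝟙 _ := by
  simp [idOrZero]

lemma partial_comp {a b c : Fin r → ℕ} {p q : Fin r} (hpq : p ≠ q) (hb : b = a + Pi.single q 1)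
    (hc : c = b + Pi.single p 1) (s : Fin r) :
    partialFactor K p s (c s) (b s) ≫ partialFactor K q s (b s) (a s) =
      if s = p ∨ s = q then (K s).d (c s) (a s) else idOrZero (K s) (c s) (a s) := by
  have hbs : s ≠ q → b s = a s := fun h => by simp [hb, h]
  have hcs : s ≠ p → c s = b s := fun h => by simp [hc, h]
  generalize c s = k at *
  generalize b s = j at *
  generalize a s = i at *
  by_cases h1 : s = p
  · obtain rfl := hbs (h1 ▸ hpq)
    simp [partialFactor, h1, hpq, idOrZero_self]
  · obtain rfl := hcs h1
    simp [partialFactor, h1, idOrZero_self]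

lemma partial_symm {n n' n'' : ℕ} (h : n' + 1 = n) (h' : n'' + 1 = n') (x : tensorX K n)
    (a : MultiDeg r n'') (p q : Fin r) (hpq : p ≠ q) :
    PiTensorProduct.map (fun s => (partialFactor K q s ((a.succ h' q).1 s) (a.1 s)).hom)
      (PiTensorProduct.map (fun s => (partialFactor K p s (((a.succ h' q).succ h p).1 s)
        ((a.succ h' q).1 s)).hom) (x ((a.succ h' q).succ h p))) =
    PiTensorProduct.map (fun s => (partialFactor K p s ((a.succ h' p).1 s) (a.1 s)).hom)
      (PiTensorProduct.map (fun s => (partialFactor K q s (((a.succ h' p).succ h q).1 s)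
        ((a.succ h' p).1 s)).hom) (x ((a.succ h' p).succ h q))) := by
  have hb : (a.succ h' q).succ h p = (a.succ h' p).succ h q :=
    Subtype.ext (add_right_comm _ _ _)
  simp only [← LinearMap.comp_apply, ← PiTensorProduct.map_comp, ← ModuleCat.hom_comp]
  simp only [partial_comp K hpq (a := a.1) (b := (a.succ h' q).1)
    (c := ((a.succ h' q).succ h p).1) rfl rfl, partial_comp K hpq.symm (a := a.1)
    (b := (a.succ h' p).1) (c := ((a.succ h' p).succ h q).1) rfl rfl]
  simp only [or_comm (a := _ = q)]
  rw [hb]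

lemma partial_self {n n' n'' : ℕ} (h : n' + 1 = n) (h' : n'' + 1 = n') (x : tensorX K n)
    (a : MultiDeg r n'') (p : Fin r) :
    PiTensorProduct.map (fun s => (partialFactor K p s ((a.succ h' p).1 s) (a.1 s)).hom)
      (PiTensorProduct.map (fun s => (partialFactor K p s (((a.succ h' p).succ h p).1 s)
        ((a.succ h' p).1 s)).hom) (x ((a.succ h' p).succ h p))) = 0 := by
  simp only [← LinearMap.comp_apply, ← PiTensorProduct.map_comp, ← ModuleCat.hom_comp]
  have : PiTensorProduct.map (R := ℚ) (fun s => (partialFactor K p s (((a.succ h' p).succ h p).1 s)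
      ((a.succ h' p).1 s) ≫ partialFactor K p s ((a.succ h' p).1 s) (a.1 s)).hom) = 0 := by
    ext y
    simp only [LinearMap.compMultilinearMap_apply, PiTensorProduct.map_tprod]
    refine (MultilinearMap.map_coord_zero _ p ?_)
    simp [partialFactor]
  rw [this]; rfl

lemma tensorD_tensorD {n n' n'' : ℕ} (h : n' + 1 = n) (h' : n'' + 1 = n') :
    tensorD K h' ∘ₗ tensorD K h = 0 := by
  refine LinearMap.ext fun x => funext fun a => ?_
  simp only [LinearMap.comp_apply, tensorD, LinearMap.pi_apply, LinearMap.sum_apply,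
    LinearMap.smul_apply, LinearMap.proj_apply, map_sum, map_smul, Finset.smul_sum, smul_smul,
    LinearMap.zero_apply, Pi.zero_apply]
  have htf : IsAddTorsionFree (⨂[ℚ] j, (K j).X (a.1 j)) := .of_module_rat _
  refine self_eq_neg.1 ?_
  nth_rw 1 [Finset.sum_comm]
  rw [← Finset.sum_neg_distrib]
  refine Finset.sum_congr rfl fun q _ => ?_
  rw [← Finset.sum_neg_distrib]
  refine Finset.sum_congr rfl fun p _ => ?_
  by_cases hpq : p = q
  · subst hpq
    rw [partial_self]; simp
  · rw [partial_symm K h h' x a q p (Ne.symm hpq), ← neg_smul]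
    congr 1
    have key : ∀ s t : Fin r, ∑ u with u < s, (a.succ h' t).1 u =
        ∑ u with u < s, a.1 u + if t < s then 1 else 0 := by
      intro s t
      simp [MultiDeg.succ, Finset.sum_add_distrib, Pi.single_apply]
    rw [key, key]
    rcases lt_or_gt_of_ne hpq with hlt | hlt
    · rw [if_pos hlt, if_neg hlt.not_gt]; ring
    · rw [if_pos hlt, if_neg hlt.not_gt]; ring

/-- The tensor product of a finite family of chain complexes of `ℚ`-vector spaces. -/
def tensorComplex : ChainComplex (ModuleCat.{u} ℚ) ℕ where
  X n := ModuleCat.of ℚ (tensorX K n)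
  d n n' := if h : n' + 1 = n then ModuleCat.ofHom (tensorD K h) else 0
  shape n n' h := dif_neg h
  d_comp_d' n n' n'' h h' := by
    rw [dif_pos (show n' + 1 = n from h), dif_pos (show n'' + 1 = n' from h'),
      ← ModuleCat.ofHom_comp, tensorD_tensorD]
    rfl

/-- The projection to the component of multidegree `a`. -/
def tensorProj (n : ℕ) (a : MultiDeg r n) :
    (tensorComplex K).X n →ₗ[ℚ] ⨂[ℚ] j, (K j).X (a.1 j) :=
  LinearMap.proj (R := ℚ) (φ := fun a : MultiDeg r n => ⨂[ℚ] j, (K j).X (a.1 j)) a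

variable {K L}

/-- The tensor product of a finite family of morphisms of chain complexes. -/
def tensorComplexMap (f : ∀ j, K j ⟶ L j) : tensorComplex K ⟶ tensorComplex L where
  f n := ModuleCat.ofHom (LinearMap.pi fun a =>
    (PiTensorProduct.map fun j => ((f j).f (a.1 j)).hom) ∘ₗ LinearMap.proj a)
  comm' n n' h := by
    have h' : n' + 1 = n := h
    simp only [tensorComplex, dif_pos h', ← ModuleCat.ofHom_comp]
    congr 1
    refine LinearMap.ext fun x => funext fun a => ?_
    simp only [LinearMap.comp_apply, tensorD, LinearMap.pi_apply, LinearMap.sum_apply,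
      LinearMap.smul_apply, LinearMap.proj_apply, map_sum, map_smul]
    refine Finset.sum_congr rfl fun p _ => ?_
    congr 1
    simp only [← LinearMap.comp_apply, ← PiTensorProduct.map_comp, ← ModuleCat.hom_comp]
    congr 2
    funext s
    congr 1
    generalize (a.succ h' p).1 s = i
    generalize a.1 s = j
    simp only [partialFactor]
    split_ifs
    · simp
    · by_cases hij : i = j
      · subst hij; simp [idOrZero]
      · simp [idOrZero, hij]

end Tensor

section Local

variable (O K : Type u) [CommRing O] [IsDomain O] [IsDiscreteValuationRing O]
  [Field K] [Algebra O K] [IsFractionRing O K]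

/-- The vertices at distance at most `m` from the base vertex. -/
abbrev VBall (m : ℕ) : Type u := {v : Vertex O K // (tree O K).edist (base O K) v ≤ m}

/-- The oriented edges both of whose endpoints have distance at most `m` from the base vertex. -/
abbrev EBall (m : ℕ) : Type u :=
  {e : Edge O K // (tree O K).edist (base O K) e.fst ≤ m ∧ (tree O K).edist (base O K) e.snd ≤ m}

variable {O K}

/-- The opposite edge. -/
def EBall.opp {m : ℕ} (e : EBall O K m) : EBall O K m := ⟨e.1.symm, e.2.2, e.2.1⟩

/-- An edge with source in the ball of radius `m` lies in the ball of radius `m + 1`. -/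
def VBall.out {m : ℕ} (v : VBall O K m) (e : {e : Edge O K // e.fst = v.1}) : EBall O K (m + 1) :=
  ⟨e.1, by
    have h1 : (tree O K).edist (base O K) e.1.fst ≤ m := by
      rw [e.2]; exact v.2
    have h2 : (tree O K).edist e.1.fst e.1.snd ≤ 1 := by
      simpa using (SimpleGraph.Walk.cons e.1.adj .nil).edist_le
    refine ⟨h1.trans (by exact_mod_cast Nat.le_succ m), ?_⟩
    push_cast
    exact SimpleGraph.edist_triangle.trans (add_le_add h1 h2)⟩

variable (O K)

/-- The functions `c` on the oriented edges in the ball of radius `m` with `c(e) + c(ē) = 0`. -/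
def edgeCochains (m : ℕ) : Submodule ℚ (EBall O K m → ℚ) where
  carrier := {c | ∀ e, c e + c e.opp = 0}
  add_mem' {c d} hc hd e := by
    simp only [Pi.add_apply]; linear_combination hc e + hd e
  zero_mem' e := by simp
  smul_mem' a c hc e := by
    simp only [Pi.smul_apply, smul_eq_mul]; linear_combination a * hc e

/-- The degeneracy map `φ(c)(v) = ∑_{s(e) = v} c(e)`. -/
def degeneracy [Finite (IsLocalRing.ResidueField O)] (m : ℕ) :
    edgeCochains O K (m + 1) →ₗ[ℚ] (VBall O K m → ℚ) where
  toFun c v := ∑ᶠ e : {e : Edge O K // e.fst = v.1}, c.1 (v.out e)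
  map_add' _ _ := funext fun _ =>
    finsum_add_distrib (Set.toFinite _) (Set.toFinite _)
  map_smul' a _ := funext fun _ => (smul_finsum' a (Set.toFinite _)).symm

/-- The two-term complex `F₀(E^{≤ m+1}, ℚ) ⟶ F(V^{≤ m}, ℚ)`, with the edge term in degree `1` and
the vertex term in degree `0`. -/
def localComplex [Finite (IsLocalRing.ResidueField O)] (m : ℕ) :
    ChainComplex (ModuleCat.{u} ℚ) ℕ where
  X
    | 0 => ModuleCat.of ℚ (VBall O K m → ℚ)
    | 1 => ModuleCat.of ℚ (edgeCochains O K (m + 1))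
    | _ + 2 => ModuleCat.of ℚ PUnit
  d
    | 1, 0 => ModuleCat.ofHom (degeneracy O K m)
    | 0, _ => 0
    | 1, _ + 1 => 0
    | _ + 2, _ => 0
  shape
    | 1, 0, h => absurd rfl h
    | 0, _, _ => rfl
    | 1, _ + 1, _ => rfl
    | _ + 2, _, _ => rfl
  d_comp_d'
    | _, 0, _, _, h => absurd h (by simp)
    | 1, 1, _, h, _ => absurd h (by simp)
    | 0, _, _, _, _ => by simp
    | _ + 2, _, _, _, _ => zero_comp

/-- Restriction of functions along the inclusion of the ball of radius `m` in the ball of radius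
`m + 1`. -/
def localRes [Finite (IsLocalRing.ResidueField O)] (m : ℕ) :
    localComplex O K (m + 1) ⟶ localComplex O K m where
  f
    | 0 => ModuleCat.ofHom
        { toFun := fun (c : VBall O K (m + 1) → ℚ) (v : VBall O K m) =>
            c ⟨v.1, v.2.trans (by exact_mod_cast Nat.le_succ m)⟩
          map_add' := fun _ _ => rfl
          map_smul' := fun _ _ => rfl }
    | 1 => ModuleCat.ofHom
        { toFun := fun (c : edgeCochains O K (m + 2)) =>
            (⟨fun e => c.1 ⟨e.1, e.2.1.trans (by exact_mod_cast Nat.le_succ (m + 1)),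
                e.2.2.trans (by exact_mod_cast Nat.le_succ (m + 1))⟩,
              fun e => c.2 _⟩ : edgeCochains O K (m + 1))
          map_add' := fun _ _ => rfl
          map_smul' := fun _ _ => rfl }
    | _ + 2 => 0
  comm'
    | 1, 0, _ => rfl
    | 0, _, h => absurd h (by simp)
    | 1, _ + 1, h => absurd h (by simp)
    | _ + 2, _, _ => zero_comp.trans zero_comp.symm

variable {O K}

/-- The value of an edge cochain at an edge. -/
def edgeValue [Finite (IsLocalRing.ResidueField O)] {m : ℕ} (e : EBall O K (m + 1)) :
    (localComplex O K m).X 1 →ₗ[ℚ] ℚ :=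
  (LinearMap.proj e : (EBall O K (m + 1) → ℚ) →ₗ[ℚ] ℚ) ∘ₗ (edgeCochains O K (m + 1)).subtype

end Local

section Global

variable {F : Type u} [Field F] [NumberField F] {r : ℕ} (𝔭 : Fin r → HeightOneSpectrum (𝓞 F))

/-- The vertices of the Bruhat-Tits tree at the finite prime `𝔮`. -/
abbrev PVertex (𝔮 : HeightOneSpectrum (𝓞 F)) : Type u :=
  Vertex (𝔮.adicCompletionIntegers F) (𝔮.adicCompletion F)

/-- The oriented edges of the Bruhat-Tits tree at the finite prime `𝔮`. -/
abbrev PEdge (𝔮 : HeightOneSpectrum (𝓞 F)) : Type u :=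
  Edge (𝔮.adicCompletionIntegers F) (𝔮.adicCompletion F)

/-- The oriented edges at `𝔮` in the ball of radius `m`. -/
abbrev PEBall (𝔮 : HeightOneSpectrum (𝓞 F)) (m : ℕ) : Type u :=
  EBall (𝔮.adicCompletionIntegers F) (𝔮.adicCompletion F) m

/-- The two-term complex `C_{𝔮,m}(ℚ)` of the tree at `𝔮`. -/
abbrev primeComplex (𝔮 : HeightOneSpectrum (𝓞 F)) (m : ℕ) : ChainComplex (ModuleCat.{u} ℚ) ℕ :=
  localComplex (𝔮.adicCompletionIntegers F) (𝔮.adicCompletion F) m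

/-- The complex `C_{S,m}(ℚ) = ⨂_{𝔭 ∈ S} C_{𝔭,m}(ℚ)`. -/
abbrev finiteLevelComplex (m : ℕ) : ChainComplex (ModuleCat.{u} ℚ) ℕ :=
  tensorComplex fun j => primeComplex (𝔭 j) m

/-- The restriction map `C_{S,m+1}(ℚ) ⟶ C_{S,m}(ℚ)`. -/
def finiteLevelRes (m : ℕ) : finiteLevelComplex 𝔭 (m + 1) ⟶ finiteLevelComplex 𝔭 m :=
  tensorComplexMap fun j =>
    localRes ((𝔭 j).adicCompletionIntegers F) ((𝔭 j).adicCompletion F) m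

/-- The inverse system of the complexes `C_{S,m}(ℚ)` with the restriction maps. -/
def tower : ℕᵒᵖ ⥤ ChainComplex (ModuleCat.{u} ℚ) ℕ :=
  Functor.ofOpSequence (X := finiteLevelComplex 𝔭) (finiteLevelRes 𝔭)

/-- The complex `C_{S,∞}(ℚ)`, the inverse limit of the `C_{S,m}(ℚ)`. -/
def limitComplex : ChainComplex (ModuleCat.{u} ℚ) ℕ := limit (tower 𝔭)

/-- The projection of `C_{S,∞}(ℚ)` to `C_{S,m}(ℚ)`. -/
def limitProj (m : ℕ) : limitComplex 𝔭 ⟶ finiteLevelComplex 𝔭 m := limit.π (tower 𝔭) (.op m)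

/-- The value at a multiedge `(e j)_j` of an element of degree `r` of `C_{S,m}(ℚ)`: on a tensor
`⨂ j, c j` of edge cochains it is `∏ j, c j (e j)`. (The components of an element of degree `r` in
multidegrees other than `(1, …, 1)` are zero.) -/
def evalTop (m : ℕ) (e : ∀ j, PEBall (𝔭 j) (m + 1)) : (finiteLevelComplex 𝔭 m).X r →ₗ[ℚ] ℚ :=
  PiTensorProduct.lift ((MultilinearMap.mkPiAlgebra ℚ (Fin r) ℚ).compLinearMap fun j =>
    edgeValue (e j)) ∘ₗ
    tensorProj (fun j => primeComplex (𝔭 j) m) r ⟨fun _ => 1, by simp⟩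

/-- The `S`-harmonic cochains with values in `ℚ`: the functions on multiedges that change sign when
one component of the multiedge is inverted, and such that for each `j`, each vertex `v` of the tree
at `𝔭 j` and each choice of the components other than the `j`-th one, the sum over the edges with
source `v` in the `j`-th component is zero. -/
def harmonicCochains : Submodule ℚ ((∀ j, PEdge (𝔭 j)) → ℚ) where
  carrier := {c |
    (∀ (e : ∀ j, PEdge (𝔭 j)) (j : Fin r), c e + c (Function.update e j (e j).symm) = 0) ∧
    (∀ (e : ∀ j, PEdge (𝔭 j)) (j : Fin r) (v : PVertex (𝔭 j)),
      ∑ᶠ e' : {e' : PEdge (𝔭 j) // e'.fst = v}, c (Function.update e j e'.1) = 0)}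
  add_mem' {c d} hc hd := by
    refine ⟨fun e j => ?_, fun e j v => ?_⟩
    · simp only [Pi.add_apply]; linear_combination hc.1 e j + hd.1 e j
    · simp only [Pi.add_apply]
      rw [finsum_add_distrib (Set.toFinite _) (Set.toFinite _), hc.2 e j v, hd.2 e j v, add_zero]
  zero_mem' := ⟨fun e j => by simp, fun e j v => by simp⟩
  smul_mem' a c hc := by
    refine ⟨fun e j => ?_, fun e j v => ?_⟩
    · simp only [Pi.smul_apply, smul_eq_mul]; linear_combination a * hc.1 e j
    · simp only [Pi.smul_apply]
      rw [← smul_finsum' a (Set.toFinite _), hc.2 e j v, smul_zero]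

end Global

end BruhatTits

end

open BruhatTits

noncomputable section

universe u

namespace BruhatTits


/-! ### Distances in the tree, expressed through lattices. -/

section Tree

variable {O K : Type*} [CommRing O] [IsDomain O] [IsDiscreteValuationRing O]
  [Field K] [Algebra O K] [IsFractionRing O K]

/-! Geometry. Every vertex has a neighbour farther from the base vertex (`exists_child`), so a
function on a ball of vertices is the degeneracy of a cochain supported on outgoing edges. If the
function vanishes inside the sphere, this cochain lives only on edges leaving the ball
(`exists_degeneracy_eq`). Hence a section of the degeneracy map at level `m` extends to level `m +
1`, and there are sections `σ m` compatible with restriction (`exists_compatible_sections`).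

Vanishing. The section in the `p`-th factor gives an operator `H_p` on the tensor product. With
Koszul signs, `H_p` anticommutes with the partial differentials `D_q` for `q ≠ p`, while `D_p H_p +
H_p D_p` is the identity on components of degree `0` in direction `p`. For a cycle `x`, the
homologous cycle `x - d H_p x` has no component of degree `0` in direction `p`, and components of
`x` that were zero remain zero. After all directions only multidegree `(1, …, 1)` can survive, and
it has total degree `r`. All of this commutes with restriction, so the boundaries found at the
finite levels form a compatible family and no derived limit intervenes
(`exists_compatible_boundary`).

Top degree. Nothing lives in degree `r + 1`, so the homology in degree `r` is the space of cycles.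
Balls are finite, hence a tensor product of edge cochain spaces is the space of functions on
multiedges antisymmetric in every component (`evalTop_ext`, `exists_evalTop_eq`). A multidegree of
total degree `r - 1` with entries at most `1` has exactly one entry `0`, so the components of `d x`
are, up to sign, the separate `D_p x`; their vanishing is harmonicity in each variable
(`finsum_evalTop_eq_zero`, `tensorD_eq_zero`). -/

lemma units_smul_mono (c : Kˣ) {M N : Submodule O (Fin 2 → K)} (h : M ≤ N) : c • M ≤ c • N :=
  Submodule.map_mono h

lemma units_smul_le {c : Kˣ} {M N : Submodule O (Fin 2 → K)} : c • M ≤ c • N ↔ M ≤ N :=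
  ⟨fun h => by simpa using units_smul_mono c⁻¹ h, units_smul_mono c⟩

lemma mem_units_smul {c : Kˣ} {M : Submodule O (Fin 2 → K)} {x : Fin 2 → K} :
    x ∈ c • M ↔ c⁻¹ • x ∈ M :=
  Submodule.mem_smul_pointwise_iff_exists _ _ _ |>.trans
    ⟨by rintro ⟨y, hy, rfl⟩; simpa using hy, fun h => ⟨_, h, by simp⟩⟩

variable (O K)

/-- A uniformizer of `O`, as a unit of `K`. -/
def unif : Kˣ := Units.mk0 (algebraMap O K (IsDiscreteValuationRing.exists_irreducible O).choose)
  (by simpa using (IsDiscreteValuationRing.exists_irreducible O).choose_spec.ne_zero)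

/-- The standard lattice `O ⊕ O`. -/
def stdLat : Submodule O (Fin 2 → K) := Submodule.span O (Set.range (Pi.basisFun K (Fin 2)))

instance : (stdLat O K).IsLattice K := isLattice_std O K

variable {O K}

lemma maximalIdeal_smul (Λ : Submodule O (Fin 2 → K)) :
    IsLocalRing.maximalIdeal O • Λ = unif O K • Λ := by
  rw [(IsDiscreteValuationRing.exists_irreducible O).choose_spec.maximalIdeal_eq,
    Submodule.ideal_span_singleton_smul]
  ext x
  constructor
  · rintro ⟨y, hy, rfl⟩
    exact ⟨y, hy, by ext i; simp [unif, Algebra.smul_def]⟩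
  · rintro ⟨y, hy, rfl⟩
    exact ⟨y, hy, by ext i; simp [unif, Algebra.smul_def]⟩

lemma unif_smul_le (Λ : Submodule O (Fin 2 → K)) : unif O K • Λ ≤ Λ := by
  rw [← maximalIdeal_smul]
  exact Submodule.smul_le_right

lemma integral_smul_eq {a : O} {c : Kˣ} (h : algebraMap O K a = c) (x : Fin 2 → K) :
    c • x = a • x := by
  ext i; simp [Units.smul_def, ← h, Algebra.smul_def]

/-- A scalar is a unit of `O`, or it or its inverse lies in the maximal ideal. -/
lemma units_trichotomy (c : Kˣ) :
    (∀ Λ : Submodule O (Fin 2 → K), c • Λ = Λ) ∨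
    (∀ Λ : Submodule O (Fin 2 → K), c • Λ ≤ unif O K • Λ) ∨
    (∀ Λ : Submodule O (Fin 2 → K), c⁻¹ • Λ ≤ unif O K • Λ) := by
  have key : ∀ (c : Kˣ) (a : O), algebraMap O K a = c →
      (∀ Λ : Submodule O (Fin 2 → K), c • Λ = Λ) ∨
      (∀ Λ : Submodule O (Fin 2 → K), c • Λ ≤ unif O K • Λ) := by
    intro c a ha
    by_cases hu : IsUnit a
    · obtain ⟨u, rfl⟩ := hu
      have hi : algebraMap O K (u⁻¹ : Oˣ) = (c⁻¹ : Kˣ) := by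
        rw [Units.val_inv_eq_inv_val, ← ha, map_units_inv]
      refine Or.inl fun Λ => le_antisymm (smul_le_of_integral ha Λ) ?_
      have := units_smul_mono c (smul_le_of_integral hi Λ)
      rwa [smul_inv_smul] at this
    · refine Or.inr fun Λ => ?_
      rw [← maximalIdeal_smul]
      rintro _ ⟨y, hy, rfl⟩
      change c • y ∈ _
      rw [integral_smul_eq ha]
      exact Submodule.smul_mem_smul ((IsLocalRing.mem_maximalIdeal a).2 hu) hy
  rcases ValuationRing.isInteger_or_isInteger O (c : K) with ⟨a, ha⟩ | ⟨a, ha⟩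
  · rcases key c a ha with h | h
    · exact Or.inl h
    · exact Or.inr (Or.inl h)
  · rcases key c⁻¹ a (by rw [ha, Units.val_inv_eq_inv_val]) with h | h
    · refine Or.inl fun Λ => ?_
      conv_lhs => rw [← h Λ]
      simp
    · exact Or.inr (Or.inr h)

lemma lattice_ne_bot {Λ : Submodule O (Fin 2 → K)} [hΛ : Λ.IsLattice K] : Λ ≠ ⊥ := by
  rintro rfl
  have := hΛ.span_eq_top
  simp at this

/-- By Nakayama, the inclusion would force the lattice to be zero. -/
lemma not_le_unif_smul {Λ : Submodule O (Fin 2 → K)} [hΛ : Λ.IsLattice K] :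
    ¬ Λ ≤ unif O K • Λ := by
  intro h
  rw [← maximalIdeal_smul] at h
  refine lattice_ne_bot (Λ := Λ) (Submodule.eq_bot_of_le_smul_of_le_jacobson_bot _ _ hΛ.fg h ?_)
  rw [IsLocalRing.jacobson_eq_maximalIdeal _ bot_ne_top]

lemma exists_unif_pow_smul_integral (c : K) :
    ∃ (n : ℕ) (a : O), algebraMap O K a = ((unif O K ^ n : Kˣ) : K) * c := by
  obtain ⟨a, b, hb, rfl⟩ := IsFractionRing.div_surjective (A := O) c
  have hb0 : b ≠ 0 := nonZeroDivisors.ne_zero hb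
  obtain ⟨n, u, rfl⟩ := IsDiscreteValuationRing.eq_unit_mul_pow_irreducible hb0
    (IsDiscreteValuationRing.exists_irreducible O).choose_spec
  refine ⟨n, a * (u⁻¹ : Oˣ), ?_⟩
  have h0 : algebraMap O K (IsDiscreteValuationRing.exists_irreducible O).choose ≠ 0 :=
    (unif O K).ne_zero
  have hu : algebraMap O K (u : O) ≠ 0 := by simp
  simp only [unif, Units.val_pow_eq_pow_val, Units.val_mk0, map_mul, map_pow, map_units_inv]
  field_simp

lemma unif_pow_smul_anti {m n : ℕ} (h : m ≤ n) (Λ : Submodule O (Fin 2 → K)) :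
    unif O K ^ n • Λ ≤ unif O K ^ m • Λ := by
  induction n, h using Nat.le_induction with
  | base => exact le_rfl
  | succ n _ ih =>
    refine le_trans ?_ ih
    rw [pow_succ, mul_smul]
    exact units_smul_mono _ (unif_smul_le Λ)

lemma unif_pow_smul_mem {m n : ℕ} (h : m ≤ n) {Λ : Submodule O (Fin 2 → K)} {x : Fin 2 → K}
    (hx : unif O K ^ m • x ∈ Λ) : unif O K ^ n • x ∈ Λ := by
  obtain ⟨k, rfl⟩ := Nat.exists_eq_add_of_le h
  have : unif O K ^ (m + k) • x ∈ unif O K ^ k • Λ := by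
    rw [mem_units_smul, pow_add, mul_comm, mul_smul, inv_smul_smul]
    exact hx
  have h2 := unif_pow_smul_anti (Nat.zero_le k) Λ this
  simpa using h2

lemma exists_unif_pow_smul_mem (Λ : Submodule O (Fin 2 → K)) [hΛ : Λ.IsLattice K]
    (x : Fin 2 → K) : ∃ n : ℕ, unif O K ^ n • x ∈ Λ := by
  have hx : x ∈ Submodule.span K (Λ : Set (Fin 2 → K)) := by rw [hΛ.span_eq_top]; trivial
  induction hx using Submodule.span_induction with
  | mem x h => exact ⟨0, by simpa using h⟩
  | zero => exact ⟨0, by simp⟩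
  | add x y _ _ hx hy =>
    obtain ⟨n, hn⟩ := hx
    obtain ⟨m, hm⟩ := hy
    refine ⟨max n m, ?_⟩
    rw [smul_add]
    exact Λ.add_mem (unif_pow_smul_mem (le_max_left _ _) hn)
      (unif_pow_smul_mem (le_max_right _ _) hm)
  | smul c x _ hx =>
    obtain ⟨n, hn⟩ := hx
    obtain ⟨m, a, ha⟩ := exists_unif_pow_smul_integral (O := O) c
    refine ⟨m + n, ?_⟩
    have : unif O K ^ (m + n) • c • x = a • unif O K ^ n • x := by
      ext i
      rw [← algebraMap_smul K a, ha]
      simp only [Pi.smul_apply, Units.smul_def, smul_eq_mul, pow_add, Units.val_mul]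
      ring
    rw [this]
    exact Λ.smul_mem a hn

lemma exists_unif_pow_smul_le (Λ Λ' : Submodule O (Fin 2 → K)) [hΛ : Λ.IsLattice K]
    [Λ'.IsLattice K] : ∃ n : ℕ, unif O K ^ n • Λ ≤ Λ' := by
  obtain ⟨s, rfl⟩ := hΛ.fg
  choose f hf using exists_unif_pow_smul_mem Λ'
  refine ⟨s.sup f, ?_⟩
  rintro _ ⟨y, hy, rfl⟩
  change unif O K ^ s.sup f • y ∈ Λ'
  induction hy using Submodule.span_induction with
  | mem x h => exact unif_pow_smul_mem (Finset.le_sup h) (hf x)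
  | zero => simp
  | add x y _ _ hx hy => rw [smul_add]; exact Λ'.add_mem hx hy
  | smul a x _ hx => rw [smul_comm]; exact Λ'.smul_mem a hx

/-- The vertex `v` has a representative between `ϖ ^ n • L` and `L`, where `L` is the standard
lattice. -/
def Within (n : ℕ) (v : Vertex O K) : Prop :=
  ∃ Λ : Lat O K, Λ.cls = v ∧ unif O K ^ n • stdLat O K ≤ Λ.1 ∧ Λ.1 ≤ stdLat O K

lemma exists_within (v : Vertex O K) : ∃ n, Within n v := by
  obtain ⟨Λ, rfl⟩ : ∃ Λ : Lat O K, Λ.cls = v := Quotient.exists_rep v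
  have := Λ.2
  obtain ⟨m, hm⟩ := exists_unif_pow_smul_le Λ.1 (stdLat O K)
  obtain ⟨n, hn⟩ := exists_unif_pow_smul_le (stdLat O K) (unif O K ^ m • Λ.1)
  exact ⟨n, ⟨_, inferInstance⟩, (Lat.cls_eq_iff.2 ⟨unif O K ^ m, rfl⟩ : Lat.cls Λ = _).symm, hn, hm⟩

lemma Within.mono {m n : ℕ} (h : m ≤ n) {v : Vertex O K} (hv : Within m v) : Within n v := by
  obtain ⟨Λ, h1, h2, h3⟩ := hv
  exact ⟨Λ, h1, (unif_pow_smul_anti h _).trans h2, h3⟩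

lemma within_base : Within 0 (base O K) :=
  ⟨_, rfl, by simp only [pow_zero, one_smul]; exact le_rfl, le_rfl⟩

lemma Within.eq_base {v : Vertex O K} (h : Within 0 v) : v = base O K := by
  obtain ⟨Λ, rfl, h2, h3⟩ := h
  rw [pow_zero, one_smul] at h2
  exact congrArg Lat.cls (Subtype.ext (le_antisymm h3 h2))

/-- A representative of `w` chosen between `ϖ • Λ` and `Λ` costs one power of `ϖ` in the lower bound
and nothing in the upper bound. -/
lemma Within.adj {n : ℕ} {v w : Vertex O K} (hv : Within n v) (h : v.Adj w) :
    Within (n + 1) w := by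
  obtain ⟨Λ, rfl, h1, h2⟩ := hv
  obtain ⟨Λ₁, Λ₂, rfl, h4, h5, h6⟩ := Vertex.Adj.symm h
  obtain ⟨c, hc⟩ := Lat.cls_eq_iff.1 h4
  have := Λ₁.2
  rw [maximalIdeal_smul] at h5
  refine ⟨⟨c • Λ₁.1, inferInstance⟩, Lat.cls_eq_iff.2 ⟨c⁻¹, by simp⟩, ?_, ?_⟩
  · rw [pow_succ', mul_smul]
    refine (units_smul_mono _ h1).trans ?_
    rw [← hc, smul_comm]
    exact units_smul_mono _ h5.le
  · exact (units_smul_mono c h6.le).trans (hc.le.trans h2)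

/-- The parent is the class of `Λ + ϖ ^ n • L`. Both inclusions `ϖ • (Λ + ϖ ^ n • L) ≤ Λ ≤ Λ + ϖ ^ n
• L` are strict, since equality in either one yields a representative of `v` between `ϖ ^ n • L` and
`L`. -/
lemma Within.parent {n : ℕ} {v : Vertex O K} (hv : Within (n + 1) v) (hn : ¬ Within n v) :
    ∃ w, Vertex.Adj w v ∧ Within n w := by
  obtain ⟨Λ, rfl, h1, h2⟩ := hv
  have := Λ.2
  refine ⟨Lat.cls ⟨Λ.1 ⊔ unif O K ^ n • stdLat O K, inferInstance⟩,
    Vertex.Adj.symm ⟨Λ, _, rfl, rfl, ?_, ?_⟩, _, rfl, le_sup_right,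
      sup_le h2 (by simpa using unif_pow_smul_anti (Nat.zero_le n) (stdLat O K))⟩
  · rw [maximalIdeal_smul]
    have hle : unif O K • (Λ.1 ⊔ unif O K ^ n • stdLat O K) ≤ Λ.1 := by
      refine (Submodule.map_sup _ _ _).le.trans (sup_le (unif_smul_le _) ?_)
      change unif O K • unif O K ^ n • stdLat O K ≤ _
      rwa [← mul_smul, ← pow_succ']
    refine lt_of_le_of_ne hle fun heq => hn ?_
    refine ⟨⟨(unif O K)⁻¹ • Λ.1, inferInstance⟩, Lat.cls_eq_iff.2 ⟨unif O K, by simp⟩, ?_, ?_⟩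
    · rw [← units_smul_le (c := unif O K), smul_inv_smul, ← mul_smul, ← pow_succ']
      exact h1
    · rw [← units_smul_le (c := unif O K), smul_inv_smul, ← heq]
      exact units_smul_mono _
        (sup_le h2 (by simpa using unif_pow_smul_anti (Nat.zero_le n) (stdLat O K)))
  · exact lt_of_le_of_ne le_sup_left fun heq =>
      hn ⟨Λ, rfl, le_sup_right.trans heq.ge, h2⟩

lemma within_of_walk {u w : Vertex O K} (p : (tree O K).Walk u w) {n : ℕ} (hu : Within n u) :
    Within (n + p.length) w := by
  induction p generalizing n with
  | nil => exact hu
  | cons h p ih =>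
    have := ih (hu.adj h)
    rwa [add_assoc, add_comm 1] at this

lemma edist_base_le_iff {n : ℕ} {v : Vertex O K} :
    (tree O K).edist (base O K) v ≤ n ↔ Within n v := by
  constructor
  · intro h
    have hr : (tree O K).Reachable (base O K) v := by
      rw [← SimpleGraph.edist_ne_top_iff_reachable]
      exact ne_top_of_le_ne_top (ENat.natCast_ne_top n) h
    obtain ⟨p, hp⟩ := hr.exists_walk_length_eq_edist
    refine (within_of_walk p within_base).mono ?_
    rw [← hp] at h
    rw [zero_add]
    exact_mod_cast h
  · intro h
    induction n generalizing v with
    | zero => rw [h.eq_base]; simp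
    | succ n ih =>
      by_cases hn : Within n v
      · exact (ih hn).trans (by exact_mod_cast Nat.le_succ n)
      · obtain ⟨w, hw, hw'⟩ := h.parent hn
        push_cast
        refine SimpleGraph.edist_triangle.trans (add_le_add (ih hw') ?_)
        simpa using (SimpleGraph.Walk.cons (show (tree O K).Adj w v from hw) .nil).edist_le

/-- At the exact distance `n`, pick `e ∈ Λ` outside `ϖ • L`. The neighbour `M = ϖ • Λ + O e` keeps a
vector that is primitive in `L`, so it cannot be divided by `ϖ` inside `L`, and it is too small to
contain `ϖ ^ n • L`. -/
lemma exists_adj_not_within {n : ℕ} {v : Vertex O K} (hv : Within n v)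
    (hmin : ∀ k < n, ¬ Within k v) : ∃ w, Vertex.Adj v w ∧ ¬ Within n w := by
  obtain ⟨Λ, rfl, h1, h2⟩ := hv
  have hΛ := Λ.2
  -- Otherwise `ϖ⁻¹ • Λ` would represent `v` with a smaller exponent.
  have hA : ¬ Λ.1 ≤ unif O K • stdLat O K := by
    intro h
    rcases n with _ | k
    · rw [pow_zero, one_smul] at h1
      exact not_le_unif_smul (h1.trans h)
    · refine hmin k k.lt_succ_self ⟨⟨(unif O K)⁻¹ • Λ.1, inferInstance⟩,
        Lat.cls_eq_iff.2 ⟨unif O K, by simp⟩, ?_, ?_⟩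
      · rw [← units_smul_le (c := unif O K), smul_inv_smul, ← mul_smul, ← pow_succ']
        exact h1
      · rwa [← units_smul_le (c := unif O K), smul_inv_smul]
  have hB : ¬ unif O K ^ n • stdLat O K ≤ unif O K • Λ.1 := by
    intro h
    rcases n with _ | k
    · rw [pow_zero, one_smul] at h
      exact not_le_unif_smul (h.trans (units_smul_mono _ h2))
    · rw [pow_succ', mul_smul, units_smul_le] at h
      exact hmin k k.lt_succ_self ⟨Λ, rfl, h, h2⟩
  obtain ⟨e, heΛ, he⟩ := SetLike.not_le_iff_exists.1 hA
  set M : Submodule O (Fin 2 → K) := unif O K • Λ.1 ⊔ Submodule.span O {e} with hM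
  have hMΛ : M ≤ Λ.1 := sup_le (unif_smul_le _)
    ((Submodule.span_singleton_le_iff_mem _ _).2 heΛ)
  have heM : e ∈ M := Submodule.mem_sup_right (Submodule.mem_span_singleton_self e)
  have hMfg : M.FG := by
    have hh : (unif O K • Λ.1).IsLattice K := inferInstance
    exact hh.fg.sup (Submodule.fg_span_singleton e)
  have hMl : M.IsLattice K := Submodule.IsLattice.of_le_of_isLattice_of_fg K
    (le_sup_left : unif O K • Λ.1 ≤ M) hMfg
  -- If `Λ = ϖ • Λ + O e`, then Nakayama gives `Λ = O e`, which has rank one instead of two.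
  have hne : ¬ Λ.1 ≤ M := by
    intro h
    have h3 : Λ.1 ≤ Submodule.span O {e} := by
      refine Submodule.le_of_le_smul_of_le_jacobson_bot (I := IsLocalRing.maximalIdeal O) hΛ.fg
        ?_ ?_
      · rw [IsLocalRing.jacobson_eq_maximalIdeal _ bot_ne_top]
      · rw [maximalIdeal_smul, sup_comm]; exact h
    have h4 : (⊤ : Submodule K (Fin 2 → K)) ≤ Submodule.span K {e} := by
      rw [← hΛ.span_eq_top, Submodule.span_le]
      intro x hx
      obtain ⟨a, rfl⟩ := Submodule.mem_span_singleton.1 (h3 hx)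
      rw [← algebraMap_smul K a e]
      exact Submodule.smul_mem _ _ (Submodule.mem_span_singleton_self e)
    have h5 := finrank_span_singleton (K := K) (v := e) (by rintro rfl; exact he (zero_mem _))
    rw [top_le_iff.1 h4, finrank_top] at h5
    simp at h5
  refine ⟨Lat.cls ⟨M, hMl⟩, Vertex.Adj.symm ⟨⟨M, hMl⟩, Λ, rfl, rfl, ?_, lt_of_le_not_ge hMΛ hne⟩,
    ?_⟩
  · rw [maximalIdeal_smul]
    exact lt_of_le_not_ge le_sup_left fun h => he (units_smul_mono _ h2 (h heM))
  · rintro ⟨Λ', h3, h4, h5⟩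
    obtain ⟨c, hc⟩ := Lat.cls_eq_iff.1 h3.symm
    simp only at hc
    rw [← hc] at h4 h5
    -- A representative `c • M` between `ϖ ^ n • L` and `L` is excluded in three cases. For a unit
    -- `c` or `c` in the maximal ideal, the lower bound conflicts with `hB`, or with `hne` when `n =
    -- 0`. For `c⁻¹` in the maximal ideal, the upper bound puts `e` in `ϖ • L`.
    rcases units_trichotomy (O := O) c with h | h | h
    · rw [h] at h4
      rcases n with _ | k
      · rw [pow_zero, one_smul] at h4
        exact hne (h2.trans h4)
      · refine hB fun f hf => ?_
        obtain ⟨y, hy, z, hz, rfl⟩ := Submodule.mem_sup.1 (h4 hf)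
        obtain ⟨a, rfl⟩ := Submodule.mem_span_singleton.1 hz
        refine Submodule.add_mem _ hy ?_
        by_cases ha : IsUnit a
        · exfalso
          -- Here `n ≥ 1`, so the element of `ϖ ^ n • L` and its part in `ϖ • Λ` both lie in `ϖ •
          -- L`, and so does their difference.
          have h6 : a • e ∈ unif O K • stdLat O K := by
            have h7 := unif_pow_smul_anti (Nat.succ_le_succ (Nat.zero_le k)) (stdLat O K) hf
            simp only [Nat.succ_eq_add_one, zero_add, pow_one] at h7
            have h8 := Submodule.sub_mem _ h7 (units_smul_mono _ h2 hy)
            simpa using h8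
          obtain ⟨u, rfl⟩ := ha
          have h9 := Submodule.smul_mem _ ((u⁻¹ : Oˣ) : O) h6
          rw [smul_smul, Units.inv_mul, one_smul] at h9
          exact he h9
        · rw [← maximalIdeal_smul]
          exact Submodule.smul_mem_smul ((IsLocalRing.mem_maximalIdeal a).2 ha) heΛ
    · exact hB (h4.trans ((units_smul_mono c hMΛ).trans (h _)))
    · refine he (h _ ?_)
      rw [mem_units_smul, inv_inv]
      refine h5 ?_
      rw [mem_units_smul, inv_smul_smul]
      exact heM

lemma exists_edist_base_eq (v : Vertex O K) : ∃ n : ℕ, (tree O K).edist (base O K) v = n := by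
  obtain ⟨n, hn⟩ := exists_within v
  obtain ⟨k, hk⟩ := ENat.ne_top_iff_exists.1
    (ne_top_of_le_ne_top (ENat.natCast_ne_top n) (edist_base_le_iff.2 hn))
  exact ⟨k, hk.symm⟩

/-- Every vertex has a neighbour that is farther away from the base vertex. -/
lemma exists_child (v : Vertex O K) : ∃ e : Edge O K, e.fst = v ∧
    ∀ n : ℕ, (tree O K).edist (base O K) v = n → ¬ (tree O K).edist (base O K) e.snd ≤ n := by
  obtain ⟨n, hn⟩ := exists_edist_base_eq v
  obtain ⟨w, hw, hw'⟩ := exists_adj_not_within (edist_base_le_iff.1 hn.le) (fun k hk h => by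
    have := edist_base_le_iff.2 h
    rw [hn] at this
    exact absurd (by exact_mod_cast this) hk.not_ge)
  refine ⟨⟨(v, w), hw⟩, rfl, fun m hm h => hw' ?_⟩
  obtain rfl : n = m := by rw [hn] at hm; exact_mod_cast hm
  exact edist_base_le_iff.1 h

end Tree


/-! ### Compatible sections of the degeneracy maps. -/

section Local

variable (O K : Type u) [CommRing O] [IsDomain O] [IsDiscreteValuationRing O]
  [Field K] [Algebra O K] [IsFractionRing O K] [Finite (IsLocalRing.ResidueField O)]

/-- Each new vertex has a parent in the previous ball, and each vertex has finitely many outgoing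
edges. -/
instance finite_vball (m : ℕ) : Finite (VBall O K m) := by
  change Finite ({v : Vertex O K | (tree O K).edist (base O K) v ≤ m} : Set _)
  simp only [edist_base_le_iff]
  rw [Set.finite_coe_iff]
  induction m with
  | zero => exact (Set.finite_singleton (base O K)).subset fun v hv => Within.eq_base hv
  | succ m ih =>
    refine (ih.union (ih.biUnion fun v _ => Set.finite_range
      fun e : {e : Edge O K // e.fst = v} => e.1.snd)).subset fun v hv => ?_
    by_cases h : Within m v
    · exact Or.inl h
    · obtain ⟨w, hw, hw'⟩ := Within.parent hv h
      exact Or.inr (Set.mem_biUnion (x := w) hw' ⟨⟨⟨(w, v), hw⟩, rfl⟩, rfl⟩)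

instance finite_eball (m : ℕ) : Finite (EBall O K m) :=
  Finite.of_injective (β := VBall O K m × VBall O K m)
    (fun e => (⟨e.1.fst, e.2.1⟩, ⟨e.1.snd, e.2.2⟩)) fun e f h => by
      simp only [Prod.mk.injEq, Subtype.mk.injEq] at h
      exact Subtype.ext (SimpleGraph.Dart.ext _ _ (Prod.ext h.1 h.2))

variable {O K}

/-- A function on the ball of radius `m` that vanishes off the sphere of radius `m` is the
degeneracy of an edge cochain that vanishes on the ball of radius `m`. -/
lemma exists_degeneracy_eq (m : ℕ) (g : VBall O K m → ℚ)
    (hg : ∀ v k, k < m → (tree O K).edist (base O K) v.1 ≤ k → g v = 0) :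
    ∃ c : edgeCochains O K (m + 1), degeneracy O K m c = g ∧
      ∀ e : EBall O K (m + 1), (tree O K).edist (base O K) e.1.fst ≤ m →
        (tree O K).edist (base O K) e.1.snd ≤ m → c.1 e = 0 := by
  classical
  choose ch hch1 hch2 using exists_child (O := O) (K := K)
  -- One chosen outward edge at each vertex `v` of the ball carries the whole value `g v`; the
  -- cochain is the antisymmetrization of `a`.
  let a : Edge O K → ℚ := fun e =>
    if h : (tree O K).edist (base O K) e.fst ≤ m ∧ e = ch e.fst then g ⟨e.fst, h.1⟩ else 0
  -- A chosen edge ending in the ball starts strictly inside it, where `g` vanishes.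
  have ha : ∀ e : Edge O K, (tree O K).edist (base O K) e.snd ≤ m → a e = 0 := by
    intro e he
    by_cases h : (tree O K).edist (base O K) e.fst ≤ m ∧ e = ch e.fst
    · obtain ⟨k, hk⟩ := exists_edist_base_eq e.fst
      have hk' := hch2 e.fst k hk
      rw [← h.2] at hk'
      have hkm : k < m := by
        by_contra hkm
        exact hk' (he.trans (by exact_mod_cast not_lt.1 hkm))
      simp only [a, dif_pos h]
      exact hg _ k hkm hk.le
    · exact dif_neg h
  refine ⟨⟨fun e => a e.1 - a e.1.symm, fun e => ?_⟩, ?_, ?_⟩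
  · simp [EBall.opp]
  · funext v
    change ∑ᶠ e : {e : Edge O K // e.fst = v.1}, (a e.1 - a e.1.symm) = g v
    have h1 : ∀ e : {e : Edge O K // e.fst = v.1}, a e.1.symm = 0 := fun e =>
      ha _ (by change (tree O K).edist (base O K) e.1.fst ≤ m; rw [e.2]; exact v.2)
    simp only [h1, sub_zero]
    rw [finsum_eq_single _ ⟨ch v.1, hch1 v.1⟩]
    · have h : (tree O K).edist (base O K) (ch v.1).fst ≤ m ∧ ch v.1 = ch (ch v.1).fst := by
        rw [hch1]; exact ⟨v.2, rfl⟩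
      simp only [a, dif_pos h]
      congr 1
      exact Subtype.ext (hch1 _)
    · intro e he
      refine dif_neg fun h => he (Subtype.ext ?_)
      rw [h.2, e.2]
  · intro e h1 h2
    change a e.1 - a e.1.symm = 0
    rw [ha _ h2, ha e.1.symm h1, sub_zero]

/-- Level `m + 1` edge cochains surject onto the fibre product of level `m` edge cochains and level
`m + 1` vertex functions. The extension of `c` by zero has the right degeneracy on the ball of
radius `m`; the error on the outer sphere is corrected by edges leaving the ball of radius `m + 1`,
so the restriction does not change. -/
lemma exists_lift (m : ℕ) (c : edgeCochains O K (m + 1)) (f : VBall O K (m + 1) → ℚ)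
    (h : degeneracy O K m c = ((localRes O K m).f 0).hom f) :
    ∃ c' : edgeCochains O K (m + 2), ((localRes O K m).f 1).hom c' = c ∧
      degeneracy O K (m + 1) c' = f := by
  classical
  let c₀ : edgeCochains O K (m + 2) :=
    ⟨fun e => if h : (tree O K).edist (base O K) e.1.fst ≤ (m + 1 : ℕ) ∧
        (tree O K).edist (base O K) e.1.snd ≤ (m + 1 : ℕ) then c.1 ⟨e.1, h⟩ else 0, fun e => by
      by_cases he : (tree O K).edist (base O K) e.1.fst ≤ (m + 1 : ℕ) ∧
        (tree O K).edist (base O K) e.1.snd ≤ (m + 1 : ℕ)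
      · have he' : (tree O K).edist (base O K) e.opp.1.fst ≤ (m + 1 : ℕ) ∧
          (tree O K).edist (base O K) e.opp.1.snd ≤ (m + 1 : ℕ) := he.symm
        exact (congrArg₂ (· + ·) (dif_pos he) (dif_pos he')).trans (c.2 ⟨e.1, he⟩)
      · have he' : ¬ ((tree O K).edist (base O K) e.opp.1.fst ≤ (m + 1 : ℕ) ∧
          (tree O K).edist (base O K) e.opp.1.snd ≤ (m + 1 : ℕ)) := fun h => he h.symm
        exact (congrArg₂ (· + ·) (dif_neg he) (dif_neg he')).trans (add_zero 0)⟩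
  have hc₀ : ((localRes O K m).f 1).hom c₀ = c := Subtype.ext (funext fun e => dif_pos e.2)
  have hd : ((localRes O K m).f 0).hom (degeneracy O K (m + 1) c₀) = degeneracy O K m c := by
    conv_rhs => rw [← hc₀]
    rfl
  obtain ⟨c₁, h1, h2⟩ := exists_degeneracy_eq (m + 1) (f - degeneracy O K (m + 1) c₀) (by
    intro v k hk hv
    have hv' : (tree O K).edist (base O K) v.1 ≤ m :=
      hv.trans (by exact_mod_cast Nat.lt_succ_iff.1 hk)
    exact (sub_eq_zero.2 (congrFun (h.symm.trans hd.symm) ⟨v.1, hv'⟩)))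
  refine ⟨c₀ + c₁, ?_, by rw [map_add, h1]; abel⟩
  have : ((localRes O K m).f 1).hom c₁ = 0 := Subtype.ext (funext fun e => h2 _ e.2.1 e.2.2)
  exact (map_add ((localRes O K m).f 1).hom c₀ c₁).trans
    ((congrArg₂ (· + ·) hc₀ this).trans (add_zero c))

variable (O K)

/-- The degeneracy maps of all balls have linear sections compatible with restriction. -/
lemma exists_compatible_sections :
    ∃ σ : ∀ m, (localComplex O K m).X 0 ⟶ (localComplex O K m).X 1,
      (∀ m, σ m ≫ (localComplex O K m).d 1 0 = 𝟙 _) ∧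
      ∀ m, σ (m + 1) ≫ (localRes O K m).f 1 = (localRes O K m).f 0 ≫ σ m := by
  let S : ℕ → Type u := fun m =>
    {s : (VBall O K m → ℚ) →ₗ[ℚ] edgeCochains O K (m + 1) // degeneracy O K m ∘ₗ s = LinearMap.id}
  let r0 : ∀ m, (VBall O K (m + 1) → ℚ) →ₗ[ℚ] (VBall O K m → ℚ) := fun m =>
    ((localRes O K m).f 0).hom
  let r1 : ∀ m, edgeCochains O K (m + 2) →ₗ[ℚ] edgeCochains O K (m + 1) := fun m =>
    ((localRes O K m).f 1).hom
  have hcomm : ∀ m, degeneracy O K m ∘ₗ r1 m = r0 m ∘ₗ degeneracy O K (m + 1) := fun m => rfl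
  have hzero : Nonempty (S 0) := by
    obtain ⟨s, hs⟩ := LinearMap.exists_rightInverse_of_surjective (degeneracy O K 0)
      (LinearMap.range_eq_top.2 fun g => by
        obtain ⟨c, hc, -⟩ := exists_degeneracy_eq 0 g (fun _ k hk => absurd hk k.not_lt_zero)
        exact ⟨c, hc⟩)
    exact ⟨⟨s, hs⟩⟩
  -- The map `T` onto the fibre product `P` has a linear right inverse `ρ`. Applying `ρ` to the pair
  -- `(s (f restricted), f)` gives a section that restricts to `s`.
  have hsucc : ∀ m (s : S m), ∃ s' : S (m + 1), r1 m ∘ₗ s'.1 = s.1 ∘ₗ r0 m := by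
    intro m s
    let P : Submodule ℚ (edgeCochains O K (m + 1) × (VBall O K (m + 1) → ℚ)) := LinearMap.eqLocus (degeneracy O K m ∘ₗ LinearMap.fst ℚ _ _)
      (r0 m ∘ₗ LinearMap.snd ℚ (edgeCochains O K (m + 1)) (VBall O K (m + 1) → ℚ))
    let T : edgeCochains O K (m + 2) →ₗ[ℚ] P :=
      ((r1 m).prod (degeneracy O K (m + 1))).codRestrict P fun c => rfl
    have : Module.Projective ℚ P := Module.Projective.of_basis (Module.Basis.ofVectorSpace ℚ P)
    obtain ⟨ρ, hρ⟩ := LinearMap.exists_rightInverse_of_surjective T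
      (LinearMap.range_eq_top.2 fun ⟨⟨c, f⟩, h⟩ => by
        obtain ⟨c', h1, h2⟩ := exists_lift m c f h
        exact ⟨c', Subtype.ext (Prod.ext h1 h2)⟩)
    let J : (VBall O K (m + 1) → ℚ) →ₗ[ℚ] P :=
      ((s.1 ∘ₗ r0 m).prod LinearMap.id).codRestrict P fun f =>
        LinearMap.congr_fun s.2 (r0 m f)
    have key : ∀ f, T (ρ (J f)) = J f := fun f => LinearMap.congr_fun hρ (J f)
    exact ⟨⟨ρ ∘ₗ J, LinearMap.ext fun f => congrArg (fun x : P => x.1.2) (key f)⟩,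
      LinearMap.ext fun f => congrArg (fun x : P => x.1.1) (key f)⟩
  choose next hnext using hsucc
  let s : ∀ m, S m := fun m => Nat.rec hzero.some next m
  exact ⟨fun m => ModuleCat.ofHom (s m).1,
    fun m => ModuleCat.hom_ext (s m).2, fun m => ModuleCat.hom_ext (hnext m (s m))⟩

end Local


/-! ### Partial homotopies on tensor products and in towers. -/

section Homotopy

variable {r : ℕ} {K L : Fin r → ChainComplex (ModuleCat.{u} ℚ) ℕ}

/-- A map from degree `0` to degree `1` of a complex, extended by zero to all pairs of degrees. -/
def raise (C : ChainComplex (ModuleCat.{u} ℚ) ℕ) (σ : C.X 0 ⟶ C.X 1) : ∀ i j, C.X i ⟶ C.X j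
  | 0, 1 => σ
  | 0, 0 => 0
  | 0, _ + 2 => 0
  | _ + 1, _ => 0

lemma raise_self (C : ChainComplex (ModuleCat.{u} ℚ) ℕ) (σ : C.X 0 ⟶ C.X 1) (i : ℕ) :
    raise C σ i i = 0 := by
  rcases i with _ | i <;> rfl

/-- The `q`-th tensor factor of the partial homotopy in direction `p`. -/
def homotopyFactor (σ : ∀ j, (K j).X 0 ⟶ (K j).X 1) (p q : Fin r) (i j : ℕ) :
    (K q).X i ⟶ (K q).X j :=
  if q = p then raise (K q) (σ q) i j else idOrZero (K q) i j

variable (K) in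
/-- The product of the tensor products of the components of all multidegrees. -/
abbrev MultiX : Type u := ∀ a : Fin r → ℕ, ⨂[ℚ] j, (K j).X (a j)

/-- The sign of a partial differential or homotopy in direction `p`. -/
def koszulSign (p : Fin r) (a : Fin r → ℕ) : ℚ := (-1) ^ (∑ q with q < p, a q)

lemma koszulSign_add_single (p q : Fin r) (a : Fin r → ℕ) :
    koszulSign p (a + Pi.single q 1) = koszulSign p a * if q < p then -1 else 1 := by
  have : ∑ u with u < p, (a + Pi.single q 1 : Fin r → ℕ) u = ∑ u with u < p, a u + if q < p then 1 else 0 := by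
    simp [Finset.sum_add_distrib, Pi.single_apply]
  rw [koszulSign, this, pow_add, koszulSign]
  split_ifs <;> simp

lemma koszulSign_mul_self (p : Fin r) (a : Fin r → ℕ) : koszulSign p a * koszulSign p a = 1 := by
  rw [koszulSign, ← pow_add, ← two_mul, pow_mul]; simp

variable (K) in
/-- The partial differential in direction `p`, in all multidegrees. -/
def partialD (p : Fin r) : MultiX K →ₗ[ℚ] MultiX K :=
  LinearMap.pi fun a => koszulSign p a •
    (PiTensorProduct.map fun q =>
      (partialFactor K p q ((a + Pi.single p 1 : Fin r → ℕ) q) (a q)).hom) ∘ₗ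
      LinearMap.proj (a + Pi.single p 1)

/-- The partial homotopy in direction `p`, in all multidegrees. -/
def partialH (σ : ∀ j, (K j).X 0 ⟶ (K j).X 1) (p : Fin r) : MultiX K →ₗ[ℚ] MultiX K :=
  LinearMap.pi fun a => koszulSign p a •
    (PiTensorProduct.map fun q =>
      (homotopyFactor σ p q ((a - Pi.single p 1 : Fin r → ℕ) q) (a q)).hom) ∘ₗ
      LinearMap.proj (a - Pi.single p 1)

lemma partialD_apply (p : Fin r) (x : MultiX K) {a c : Fin r → ℕ} (h : c = a + Pi.single p 1) :
    partialD K p x a = koszulSign p a •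
      PiTensorProduct.map (fun q => (partialFactor K p q (c q) (a q)).hom) (x c) := by
  subst h; rfl

lemma partialH_apply (σ : ∀ j, (K j).X 0 ⟶ (K j).X 1) (p : Fin r) (x : MultiX K)
    {a c : Fin r → ℕ} (h : a = c + Pi.single p 1) :
    partialH σ p x a = koszulSign p a •
      PiTensorProduct.map (fun q => (homotopyFactor σ p q (c q) (a q)).hom) (x c) := by
  obtain rfl : a - Pi.single p 1 = c := by rw [h, add_tsub_cancel_right]
  rfl

lemma map_eq_zero_of_factor {V W : Fin r → Type*} [∀ j, AddCommMonoid (V j)] [∀ j, Module ℚ (V j)]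
    [∀ j, AddCommMonoid (W j)] [∀ j, Module ℚ (W j)] (f : ∀ j, V j →ₗ[ℚ] W j) (p : Fin r)
    (hp : f p = 0) (x : ⨂[ℚ] j, V j) : PiTensorProduct.map f x = 0 := by
  have : PiTensorProduct.map f = 0 := by
    ext m
    simp only [LinearMap.compMultilinearMap_apply, PiTensorProduct.map_tprod]
    exact (PiTensorProduct.tprod ℚ).map_coord_zero p (by simp [hp])
  rw [this]; rfl

/-- For `a p = 0` the truncated subtraction leaves `a` unchanged, so the `p`-th factor is a diagonal
entry of `raise`, which is zero. -/
lemma partialH_apply_of_eq_zero (σ : ∀ j, (K j).X 0 ⟶ (K j).X 1) (p : Fin r) (x : MultiX K)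
    {a : Fin r → ℕ} (h : a p = 0) : partialH σ p x a = 0 := by
  change koszulSign p a • PiTensorProduct.map (fun q =>
      (homotopyFactor σ p q ((a - Pi.single p 1 : Fin r → ℕ) q) (a q)).hom) _ = 0
  rw [map_eq_zero_of_factor _ p, smul_zero]
  have h1 : (a - Pi.single p 1 : Fin r → ℕ) p = a p := by simp [h]
  rw [h1, homotopyFactor, if_pos rfl, raise_self]
  rfl

lemma exists_eq_add_single {a : Fin r → ℕ} {p : Fin r} (h : a p ≠ 0) :
    ∃ b : Fin r → ℕ, a = b + Pi.single p 1 := by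
  refine ⟨a - Pi.single p 1, (tsub_add_cancel_of_le fun q => ?_).symm⟩
  by_cases hq : q = p
  · subst hq; simpa using Nat.one_le_iff_ne_zero.2 h
  · simp [hq]

lemma factor_comm (σ : ∀ j, (K j).X 0 ⟶ (K j).X 1) {p q : Fin r} (hpq : p ≠ q)
    {a b c t : Fin r → ℕ} (ha : a = b + Pi.single p 1) (hc : c = b + Pi.single q 1)
    (ht : t = a + Pi.single q 1) (s : Fin r) :
    homotopyFactor σ p s (c s) (t s) ≫ partialFactor K q s (t s) (a s) =
      partialFactor K q s (c s) (b s) ≫ homotopyFactor σ p s (b s) (a s) := by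
  have h1 : s ≠ p → a s = b s := fun h => by simp [ha, h]
  have h2 : s ≠ q → c s = b s := fun h => by simp [hc, h]
  have h3 : s ≠ q → t s = a s := fun h => by simp [ht, h]
  have h4 : s ≠ p → t s = c s := fun h => by simp [ht, hc, ha, h]
  -- The degrees become free variables so that the equalities between them can be substituted in the
  -- dependent types.
  generalize t s = l at *
  generalize c s = k at *
  generalize a s = i at *
  generalize b s = j at *
  by_cases hp : s = p
  · have hq : s ≠ q := hp ▸ hpq
    obtain rfl := h2 hq
    obtain rfl := h3 hq
    simp [partialFactor, homotopyFactor, hp, hpq, idOrZero_self]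
  · obtain rfl := h1 hp
    obtain rfl := h4 hp
    simp [homotopyFactor, hp, idOrZero_self]

lemma partialD_partialH_of_ne (σ : ∀ j, (K j).X 0 ⟶ (K j).X 1) {p q : Fin r} (hpq : p ≠ q)
    (x : MultiX K) : partialD K q (partialH σ p x) + partialH σ p (partialD K q x) = 0 := by
  funext a
  change partialD K q (partialH σ p x) a + partialH σ p (partialD K q x) a = 0
  by_cases h0 : a p = 0
  · rw [partialH_apply_of_eq_zero σ p _ h0, partialD_apply q _ rfl,
      partialH_apply_of_eq_zero σ p x (a := a + Pi.single q 1) (by simp [h0, hpq])]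
    simp
  · obtain ⟨b, hb⟩ := exists_eq_add_single h0
    have ht : a + Pi.single q 1 = b + Pi.single q 1 + Pi.single p 1 := by
      rw [hb]; exact add_right_comm _ _ _
    rw [partialD_apply q _ rfl, partialH_apply σ p x ht, partialH_apply σ p _ hb,
      partialD_apply q x (a := b) rfl]
    simp only [map_smul, smul_smul, ← LinearMap.comp_apply, ← PiTensorProduct.map_comp,
      ← ModuleCat.hom_comp]
    simp only [factor_comm σ hpq hb rfl rfl]
    rw [← add_smul]
    convert zero_smul ℚ _
    -- Exactly one of `p < q` and `q < p` holds, so just one of the two composites acquires a sign.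
    rw [koszulSign_add_single, hb, koszulSign_add_single, koszulSign_add_single]
    rcases lt_or_gt_of_ne hpq with h | h
    · rw [if_pos h, if_neg h.not_gt, if_neg (lt_irrefl p)]; ring
    · rw [if_pos h, if_neg h.not_gt, if_neg (lt_irrefl p)]; ring

/-- In degree `0` of the `p`-th factor the term `H_p D_p` is absent and `D_p H_p` is the composite
of the section with the differential; the two Koszul signs agree. -/
lemma partialD_partialH_self (σ : ∀ j, (K j).X 0 ⟶ (K j).X 1) (p : Fin r)
    (hσ : σ p ≫ (K p).d 1 0 = 𝟙 _) (x : MultiX K) {a : Fin r → ℕ} (h0 : a p = 0) :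
    partialD K p (partialH σ p x) a + partialH σ p (partialD K p x) a = x a := by
  rw [partialH_apply_of_eq_zero σ p _ h0, partialD_apply p _ rfl, partialH_apply σ p x rfl,
    koszulSign_add_single, if_neg (lt_irrefl p)]
  simp only [map_smul, smul_smul, ← LinearMap.comp_apply, ← PiTensorProduct.map_comp,
      ← ModuleCat.hom_comp]
  rw [mul_one, koszulSign_mul_self, one_smul, add_zero]
  refine Eq.trans ?_ (LinearMap.congr_fun PiTensorProduct.map_id (x a))
  congr 2
  funext s
  change _ = ModuleCat.Hom.hom (𝟙 ((K s).X (a s)))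
  congr 1
  by_cases hs : s = p
  · subst hs
    have h1 : (a + Pi.single s 1 : Fin r → ℕ) s = 1 := by simp [h0]
    rw [h1]
    generalize a s = i at *
    subst h0
    simp [homotopyFactor, partialFactor, raise, hσ]
  · have h1 : (a + Pi.single p 1 : Fin r → ℕ) s = a s := by simp [hs]
    rw [h1]
    simp [homotopyFactor, partialFactor, hs, idOrZero_self]

/-- Both composites preserve multidegrees. Hence treating one direction does not undo the vanishing
achieved in another. -/
lemma partialD_partialH_eq_zero (σ : ∀ j, (K j).X 0 ⟶ (K j).X 1) (p : Fin r)
    (x : MultiX K) {a : Fin r → ℕ} (hx : x a = 0) :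
    partialD K p (partialH σ p x) a + partialH σ p (partialD K p x) a = 0 := by
  rw [partialD_apply p _ rfl, partialH_apply σ p x rfl, hx]
  by_cases h0 : a p = 0
  · rw [partialH_apply_of_eq_zero σ p _ h0]; simp
  · obtain ⟨b, hb⟩ := exists_eq_add_single h0
    rw [partialH_apply σ p _ hb, partialD_apply p x hb, hx]
    simp

/-- The extension by zero of an element of total degree `n`. -/
def extendX {n : ℕ} (x : tensorX K n) : MultiX K := fun a =>
  if h : ∑ j, a j = n then x ⟨a, h⟩ else 0

lemma extendX_apply {n : ℕ} (x : tensorX K n) (a : MultiDeg r n) : extendX x a.1 = x a :=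
  dif_pos a.2

lemma extendX_eq_zero {n : ℕ} (x : tensorX K n) {a : Fin r → ℕ} (h : ∑ j, a j ≠ n) :
    extendX x a = 0 :=
  dif_neg h

lemma extendX_ext {n : ℕ} {x : tensorX K n} {y : MultiX K} (h : ∀ a : MultiDeg r n, x a = y a.1)
    (h0 : ∀ a : Fin r → ℕ, ∑ j, a j ≠ n → y a = 0) : extendX x = y := by
  funext a
  by_cases ha : ∑ j, a j = n
  · exact (extendX_apply x ⟨a, ha⟩).trans (h ⟨a, ha⟩)
  · rw [h0 a ha, extendX_eq_zero x ha]

lemma sum_add_single (a : Fin r → ℕ) (p : Fin r) :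
    ∑ j, (a + Pi.single p 1 : Fin r → ℕ) j = ∑ j, a j + 1 := by
  simp [Finset.sum_add_distrib]

/-- The partial homotopy in direction `p`, in total degree `n`. -/
def tensorH (σ : ∀ j, (K j).X 0 ⟶ (K j).X 1) (p : Fin r) {n : ℕ} (x : tensorX K n) :
    tensorX K (n + 1) := fun a => partialH σ p (extendX x) a.1

lemma extendX_tensorH (σ : ∀ j, (K j).X 0 ⟶ (K j).X 1) (p : Fin r) {n : ℕ} (x : tensorX K n) :
    extendX (tensorH σ p x) = partialH σ p (extendX x) := by
  refine extendX_ext (fun _ => rfl) fun a ha => ?_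
  by_cases h0 : a p = 0
  · exact partialH_apply_of_eq_zero σ p _ h0
  · obtain ⟨b, hb⟩ := exists_eq_add_single h0
    rw [partialH_apply σ p _ hb, extendX_eq_zero]
    · simp
    · intro h
      rw [hb, sum_add_single, h] at ha
      exact ha rfl

lemma sum_partialD_extendX_apply {n n' : ℕ} (h : n' + 1 = n) (x : tensorX K n)
    (a : MultiDeg r n') : (∑ p, partialD K p) (extendX x) a.1 = tensorD K h x a := by
  simp only [LinearMap.sum_apply, Finset.sum_apply, tensorD, LinearMap.pi_apply]
  refine Finset.sum_congr rfl fun p _ => ?_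
  rw [partialD_apply p _ (c := (a.succ h p).1) rfl, extendX_apply]
  rfl

lemma sum_partialD_extendX_eq_zero {n : ℕ} (x : tensorX K n)
    (hx : ∀ n' (h : n' + 1 = n), tensorD K h x = 0) :
    (∑ p, partialD K p) (extendX x) = 0 := by
  funext a
  by_cases h : ∑ j, a j + 1 = n
  · rw [show a = (⟨a, rfl⟩ : MultiDeg r (∑ j, a j)).1 from rfl, sum_partialD_extendX_apply h]
    exact congrFun (hx _ h) ⟨a, rfl⟩
  · rw [LinearMap.sum_apply, Finset.sum_apply]
    refine Finset.sum_eq_zero fun p _ => ?_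
    rw [partialD_apply p _ rfl, extendX_eq_zero]
    · simp
    · rwa [sum_add_single]

/-- A tensor product with a zero factor is zero: its identity map has a zero factor. -/
lemma tensorX_component_eq_zero {n : ℕ} (hK : ∀ j i, Subsingleton ((K j).X (i + 2)))
    (x : tensorX K n) {a : MultiDeg r n} {p : Fin r} (h : 2 ≤ a.1 p) : x a = 0 := by
  have hs : Subsingleton ((K p).X (a.1 p)) := by
    obtain ⟨i, hi⟩ := Nat.exists_eq_add_of_le h
    rw [hi, add_comm]; exact hK p i
  have := map_eq_zero_of_factor (fun j => (LinearMap.id : (K j).X (a.1 j) →ₗ[ℚ] _)) p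
    (LinearMap.ext fun y => Subsingleton.elim _ _) (x a)
  rwa [PiTensorProduct.map_id] at this

/-- The cycle homologous to the cycle `x` by the partial homotopy in direction `p`. -/
def project (σ : ∀ j, (K j).X 0 ⟶ (K j).X 1) (p : Fin r) {n : ℕ} (x : tensorX K n) :
    tensorX K n := x - tensorD K rfl (tensorH σ p x)

/-- On a cycle, `d H_p x = (d H_p + H_p d) x`, and the anticommutation relations leave only the
terms in direction `p`. -/
lemma project_apply (σ : ∀ j, (K j).X 0 ⟶ (K j).X 1) (p : Fin r) {n : ℕ} (x : tensorX K n)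
    (hx : ∀ n' (h : n' + 1 = n), tensorD K h x = 0) (a : MultiDeg r n) :
    project σ p x a = x a - (partialD K p (partialH σ p (extendX x)) a.1 +
      partialH σ p (partialD K p (extendX x)) a.1) := by
  have h1 : (∑ q, partialD K q) (partialH σ p (extendX x)) +
      partialH σ p ((∑ q, partialD K q) (extendX x)) =
      partialD K p (partialH σ p (extendX x)) + partialH σ p (partialD K p (extendX x)) := by
    rw [LinearMap.sum_apply, LinearMap.sum_apply, map_sum, ← Finset.sum_add_distrib]
    exact Finset.sum_eq_single p
      (fun q _ hq => partialD_partialH_of_ne σ (Ne.symm hq) _) (by simp)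
  rw [sum_partialD_extendX_eq_zero x hx, map_zero, add_zero] at h1
  change x a - tensorD K rfl (tensorH σ p x) a = _
  rw [← sum_partialD_extendX_apply, extendX_tensorH, h1]
  rfl

lemma project_apply_eq_zero (σ : ∀ j, (K j).X 0 ⟶ (K j).X 1) (p : Fin r) {n : ℕ}
    (x : tensorX K n) (hx : ∀ n' (h : n' + 1 = n), tensorD K h x = 0) {a : MultiDeg r n}
    (ha : x a = 0) : project σ p x a = 0 := by
  rw [project_apply σ p x hx, partialD_partialH_eq_zero σ p _ (by rw [extendX_apply, ha]), ha,
    sub_zero]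

lemma project_apply_of_ne_one (hK : ∀ j i, Subsingleton ((K j).X (i + 2)))
    (σ : ∀ j, (K j).X 0 ⟶ (K j).X 1) (p : Fin r)
    (hσ : σ p ≫ (K p).d 1 0 = 𝟙 _) {n : ℕ} (x : tensorX K n)
    (hx : ∀ n' (h : n' + 1 = n), tensorD K h x = 0) {a : MultiDeg r n} (ha : a.1 p ≠ 1) :
    project σ p x a = 0 := by
  by_cases h0 : a.1 p = 0
  · rw [project_apply σ p x hx, partialD_partialH_self σ p hσ _ h0, extendX_apply, sub_self]
  · exact tensorX_component_eq_zero hK _ (p := p) (by lia)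

lemma tensorD_project (σ : ∀ j, (K j).X 0 ⟶ (K j).X 1) (p : Fin r) {n : ℕ} (x : tensorX K n)
    (hx : ∀ n' (h : n' + 1 = n), tensorD K h x = 0) (n' : ℕ) (h : n' + 1 = n) :
    tensorD K h (project σ p x) = 0 := by
  rw [project, map_sub, hx, ← LinearMap.comp_apply, tensorD_tensorD, LinearMap.zero_apply, sub_zero]

/-- The map in total degree `n` of the tensor product of morphisms of complexes. -/
def tensorF (f : ∀ j, K j ⟶ L j) (n : ℕ) : tensorX K n →ₗ[ℚ] tensorX L n :=
  ((tensorComplexMap f).f n).hom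

lemma tensorF_apply (f : ∀ j, K j ⟶ L j) {n : ℕ} (x : tensorX K n) (a : MultiDeg r n) :
    tensorF f n x a = PiTensorProduct.map (fun j => ((f j).f (a.1 j)).hom) (x a) := rfl

lemma tensorComplex_d_apply {n n' : ℕ} (h : n' + 1 = n) (x : tensorX K n) :
    ((tensorComplex K).d n n').hom x = tensorD K h x := by
  simp only [tensorComplex, dif_pos h]; rfl

lemma tensorF_tensorD (f : ∀ j, K j ⟶ L j) {n n' : ℕ} (h : n' + 1 = n) (x : tensorX K n) :
    tensorF f n' (tensorD K h x) = tensorD L h (tensorF f n x) := by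
  have := LinearMap.congr_fun (congrArg ModuleCat.Hom.hom ((tensorComplexMap f).comm n n')) x
  exact (congrArg (tensorF f n') (tensorComplex_d_apply h x)).symm.trans
    (this.symm.trans (tensorComplex_d_apply h _))

lemma tensorF_tensorH (f : ∀ j, K j ⟶ L j) (σ : ∀ j, (K j).X 0 ⟶ (K j).X 1)
    (τ : ∀ j, (L j).X 0 ⟶ (L j).X 1) (h : ∀ j, σ j ≫ (f j).f 1 = (f j).f 0 ≫ τ j) (p : Fin r)
    {n : ℕ} (x : tensorX K n) :
    tensorF f (n + 1) (tensorH σ p x) = tensorH τ p (tensorF f n x) := by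
  funext a
  rw [tensorF_apply]
  by_cases h0 : a.1 p = 0
  · simp only [tensorH]
    rw [partialH_apply_of_eq_zero σ p _ h0, partialH_apply_of_eq_zero τ p _ h0, map_zero]
  · obtain ⟨b, hb⟩ := exists_eq_add_single h0
    have hbn : ∑ j, b j = n := by
      have := a.2
      rw [hb, sum_add_single] at this
      exact Nat.succ_injective this
    simp only [tensorH]
    rw [partialH_apply σ p _ hb, partialH_apply τ p _ hb,
      show b = (⟨b, hbn⟩ : MultiDeg r n).1 from rfl, extendX_apply, extendX_apply,
      tensorF_apply, map_smul]
    simp only [← LinearMap.comp_apply, ← PiTensorProduct.map_comp, ← ModuleCat.hom_comp]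
    congr 3
    funext s
    congr 1
    generalize a.1 s = i
    generalize b s = j
    simp only [homotopyFactor]
    split_ifs
    · rcases j with _ | j
      · rcases i with _ | _ | i
        · exact zero_comp.trans comp_zero.symm
        · exact h s
        · exact zero_comp.trans comp_zero.symm
      · exact zero_comp.trans comp_zero.symm
    · by_cases hij : j = i
      · subst hij; simp [idOrZero]
      · simp [idOrZero, hij]

/-- In a tower of tensor products of complexes with compatible contractions in degree `0`, a
compatible family of cycles in a degree other than `r` is a boundary of a compatible family. -/
theorem exists_compatible_boundary (K : ℕ → Fin r → ChainComplex (ModuleCat.{u} ℚ) ℕ)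
    (hK : ∀ m j i, Subsingleton ((K m j).X (i + 2))) (f : ∀ m j, K (m + 1) j ⟶ K m j)
    (σ : ∀ m j, (K m j).X 0 ⟶ (K m j).X 1) (hσ : ∀ m j, σ m j ≫ (K m j).d 1 0 = 𝟙 _)
    (hfσ : ∀ m j, σ (m + 1) j ≫ (f m j).f 1 = (f m j).f 0 ≫ σ m j) {n : ℕ} (hn : n ≠ r)
    (z : ∀ m, tensorX (K m) n)
    (hz : ∀ m, tensorF (f m) n (z (m + 1)) = z m)
    (hdz : ∀ m n' (h : n' + 1 = n), tensorD (K m) h (z m) = 0) :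
    ∃ w : ∀ m, tensorX (K m) (n + 1),
      (∀ m, tensorF (f m) (n + 1) (w (m + 1)) = w m) ∧ ∀ m, tensorD (K m) rfl (w m) = z m := by
  -- Invariant after the first `k` directions: `z = x + d w` with both families compatible, and
  -- every component of `x` has degree `1` in those directions.
  have key : ∀ k ≤ r, ∃ (x : ∀ m, tensorX (K m) n) (w : ∀ m, tensorX (K m) (n + 1)),
      (∀ m, tensorF (f m) n (x (m + 1)) = x m) ∧
      (∀ m n' (h : n' + 1 = n), tensorD (K m) h (x m) = 0) ∧
      (∀ m, tensorF (f m) (n + 1) (w (m + 1)) = w m) ∧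
      (∀ m, z m = x m + tensorD (K m) rfl (w m)) ∧
      ∀ m (a : MultiDeg r n) (p : Fin r), p.1 < k → a.1 p ≠ 1 → x m a = 0 := by
    intro k hk
    induction k with
    | zero => exact ⟨z, 0, hz, hdz, fun m => map_zero _,
        fun m => by simp, fun m a p hp => absurd hp (Nat.not_lt_zero _)⟩
    | succ k ih =>
      obtain ⟨x, w, h1, h2, h3, h4, h5⟩ := ih (Nat.le_of_succ_le hk)
      let p : Fin r := ⟨k, hk⟩
      have hH : ∀ m, tensorF (f m) (n + 1) (tensorH (σ (m + 1)) p (x (m + 1))) =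
          tensorH (σ m) p (x m) := by
        intro m
        rw [tensorF_tensorH (f m) (σ (m + 1)) (σ m) (hfσ m) p, h1]
      refine ⟨fun m => project (σ m) p (x m), fun m => w m + tensorH (σ m) p (x m), fun m => ?_,
        fun m => tensorD_project (σ m) p (x m) (h2 m), fun m => ?_, fun m => ?_,
        fun m a q hq ha => ?_⟩
      · simp only [project]
        rw [map_sub, h1, tensorF_tensorD, hH]
      · rw [map_add, h3, hH]
      · simp only [project]
        rw [h4 m, map_add]; abel
      · by_cases hqp : q = p
        · exact project_apply_of_ne_one (hK m) (σ m) p (hσ m p) _ (h2 m) (hqp ▸ ha)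
        · exact project_apply_eq_zero (σ m) p _ (h2 m) (h5 m a q
            (lt_of_le_of_ne (Nat.lt_succ_iff.1 hq) fun h => hqp (Fin.ext h)) ha)
  obtain ⟨x, w, -, -, h3, h4, h5⟩ := key r le_rfl
  refine ⟨w, h3, fun m => ?_⟩
  have : x m = 0 := by
    funext a
    -- Only the multidegree `(1, …, 1)` could survive, but its total degree is `r ≠ n`.
    by_cases ha : ∀ p, a.1 p = 1
    · exact absurd (by rw [← a.2, Finset.sum_congr rfl fun p _ => ha p]; simp) hn
    · obtain ⟨p, hp⟩ := not_forall.1 ha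
      exact h5 m a p p.2 hp
  rw [h4 m, this, zero_add]

end Homotopy


/-! ### Elements of limits and of cycle modules. -/

section Elements

/-- A compatible sequence of elements is an element of the limit. -/
lemma exists_element_of_isLimit {G : ℕᵒᵖ ⥤ ModuleCat.{u} ℚ} {c : Cone G} (hc : IsLimit c)
    (w : ∀ m, G.obj (.op m))
    (hw : ∀ m, (G.map (homOfLE (Nat.le_add_right m 1)).op).hom (w (m + 1)) = w m) :
    ∃ x : c.pt, ∀ m, (c.π.app (.op m)).hom x = w m := by
  -- An element is a map from `ℚ`, lifted to the universe of the category; a compatible sequence is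
  -- then a cone.
  let app : ∀ m : ℕ, ModuleCat.of ℚ (ULift.{u} ℚ) ⟶ G.obj ⟨m⟩ := fun m =>
    ModuleCat.ofHom ((LinearMap.toSpanSingleton ℚ (G.obj ⟨m⟩) (w m)) ∘ₗ ULift.moduleEquiv.toLinearMap)
  let d : Cone G := ⟨ModuleCat.of ℚ (ULift.{u} ℚ),
    NatTrans.ofOpSequence (F := (Functor.const ℕᵒᵖ).obj _) app fun m => by
      ext
      simp [app, hw]⟩
  refine ⟨(hc.lift d).hom ⟨1⟩, fun m => ?_⟩
  have := LinearMap.congr_fun (congrArg ModuleCat.Hom.hom (hc.fac d (.op m))) ⟨1⟩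
  refine Eq.trans this ?_
  change (app m).hom ⟨1⟩ = w m
  simp [app]

lemma exists_cycle {C : ChainComplex (ModuleCat.{u} ℚ) ℕ} {n : ℕ} (x : C.X n)
    (hx : ∀ n', (C.d n n').hom x = 0) : ∃ z : C.cycles n, (C.iCycles n).hom z = x := by
  let k : ModuleCat.of ℚ (ULift.{u} ℚ) ⟶ C.X n :=
    ModuleCat.ofHom ((LinearMap.toSpanSingleton ℚ (C.X n) x) ∘ₗ ULift.moduleEquiv.toLinearMap)
  have hk : k ≫ C.d n ((ComplexShape.down ℕ).next n) = 0 := by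
    ext
    simp [k, hx]
  refine ⟨(C.liftCycles k _ rfl hk).hom ⟨1⟩, ?_⟩
  have := LinearMap.congr_fun (congrArg ModuleCat.Hom.hom (C.liftCycles_i k _ rfl hk)) ⟨1⟩
  refine Eq.trans this ?_
  simp [k]

lemma isZero_homology_of_forall {C : ChainComplex (ModuleCat.{u} ℚ) ℕ} {n : ℕ}
    (h : ∀ x : C.X n, (∀ n', (C.d n n').hom x = 0) → ∃ y, (C.d (n + 1) n).hom y = x) :
    IsZero (C.homology n) := by
  refine HomologicalComplex.ExactAt.isZero_homology ?_
  rw [C.exactAt_iff' (n + 1) n ((ComplexShape.down ℕ).next n) (by simp) rfl,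
    ShortComplex.moduleCat_exact_iff]
  intro x hx
  refine h x fun n' => ?_
  by_cases hn : (ComplexShape.down ℕ).Rel n n'
  · obtain rfl := (ComplexShape.down ℕ).next_eq' hn
    exact hx
  · rw [C.shape _ _ hn]; rfl

end Elements

/-! ### The limit complex and the vanishing below and above the top degree. -/

section Global

variable {F : Type u} [Field F] [NumberField F] {r : ℕ} (𝔭 : Fin r → HeightOneSpectrum (𝓞 F))

/-- The family of local complexes at level `m`. -/
abbrev localFamily (m : ℕ) (j : Fin r) : ChainComplex (ModuleCat.{u} ℚ) ℕ := primeComplex (𝔭 j) m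

/-- The restriction map of the tensor products in total degree `n`. -/
def resX (m n : ℕ) : tensorX (localFamily 𝔭 (m + 1)) n →ₗ[ℚ] tensorX (localFamily 𝔭 m) n :=
  tensorF (fun j => localRes ((𝔭 j).adicCompletionIntegers F) ((𝔭 j).adicCompletion F) m) n

/-- The projection of the limit to level `m` in total degree `n`. -/
def projX (m n : ℕ) : (limitComplex 𝔭).X n →ₗ[ℚ] tensorX (localFamily 𝔭 m) n :=
  ((limitProj 𝔭 m).f n).hom

lemma resX_projX (m n : ℕ) (x : (limitComplex 𝔭).X n) :
    resX 𝔭 m n (projX 𝔭 (m + 1) n x) = projX 𝔭 m n x := by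
  have h := limit.w (tower 𝔭) (homOfLE (Nat.le_add_right m 1)).op
  rw [tower, Functor.ofOpSequence_map_homOfLE_succ] at h
  exact LinearMap.congr_fun (congrArg ModuleCat.Hom.hom
    (congrArg (fun φ => HomologicalComplex.Hom.f φ n) h)) x

/-- Each degree of the limit complex is a limit. -/
def isLimitDegree (n : ℕ) :
    IsLimit ((HomologicalComplex.eval (ModuleCat.{u} ℚ) (ComplexShape.down ℕ) n).mapCone
      (limit.cone (tower 𝔭))) :=
  isLimitOfPreserves _ (limit.isLimit (tower 𝔭))

lemma projX_ext {n : ℕ} {x y : (limitComplex 𝔭).X n} (h : ∀ m, projX 𝔭 m n x = projX 𝔭 m n y) :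
    x = y :=
  Concrete.isLimit_ext _ (isLimitDegree 𝔭 n) x y fun m => h m.unop

lemma exists_projX_eq {n : ℕ} (w : ∀ m, tensorX (localFamily 𝔭 m) n)
    (hw : ∀ m, resX 𝔭 m n (w (m + 1)) = w m) :
    ∃ x : (limitComplex 𝔭).X n, ∀ m, projX 𝔭 m n x = w m := by
  refine exists_element_of_isLimit (isLimitDegree 𝔭 n) w fun m => ?_
  have h : (tower 𝔭 ⋙ HomologicalComplex.eval _ _ n).map (homOfLE (Nat.le_add_right m 1)).op =
      (finiteLevelRes 𝔭 m).f n := by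
    exact congrArg (fun φ => HomologicalComplex.Hom.f φ n)
      (Functor.ofOpSequence_map_homOfLE_succ (finiteLevelRes 𝔭) m)
  rw [h]
  exact hw m

lemma projX_d {n n' : ℕ} (h : n' + 1 = n) (m : ℕ) (x : (limitComplex 𝔭).X n) :
    projX 𝔭 m n' (((limitComplex 𝔭).d n n').hom x) =
      tensorD (localFamily 𝔭 m) h (projX 𝔭 m n x) := by
  have := LinearMap.congr_fun (congrArg ModuleCat.Hom.hom ((limitProj 𝔭 m).comm n n')) x
  exact this.symm.trans (tensorComplex_d_apply h _)

lemma limit_d_eq_zero_iff {n : ℕ} (x : (limitComplex 𝔭).X n) :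
    (∀ n', ((limitComplex 𝔭).d n n').hom x = 0) ↔
      ∀ m n' (h : n' + 1 = n), tensorD (localFamily 𝔭 m) h (projX 𝔭 m n x) = 0 := by
  constructor
  · intro hx m n' h
    rw [← projX_d, hx, map_zero]
  · intro hx n'
    by_cases h : n' + 1 = n
    · refine projX_ext 𝔭 fun m => ?_
      rw [projX_d 𝔭 h, hx, map_zero]
    · rw [(limitComplex 𝔭).shape n n' h]; rfl

instance subsingleton_localFamily (m : ℕ) (j : Fin r) (i : ℕ) :
    Subsingleton ((localFamily 𝔭 m j).X (i + 2)) :=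
  inferInstanceAs (Subsingleton PUnit)

theorem isZero_homology_limitComplex {i : ℕ} (hi : i ≠ r) :
    IsZero ((limitComplex 𝔭).homology i) := by
  refine isZero_homology_of_forall fun x hx => ?_
  rw [limit_d_eq_zero_iff] at hx
  choose σ hσ1 hσ2 using fun j => exists_compatible_sections
    ((𝔭 j).adicCompletionIntegers F) ((𝔭 j).adicCompletion F)
  obtain ⟨w, hw1, hw2⟩ := exists_compatible_boundary (localFamily 𝔭)
    (subsingleton_localFamily 𝔭) (fun m j => localRes _ _ m) (fun m j => σ j m)
    (fun m j => hσ1 j m) (fun m j => hσ2 j m) hi (fun m => projX 𝔭 m i x)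
    (fun m => resX_projX 𝔭 m i x) hx
  obtain ⟨y, hy⟩ := exists_projX_eq 𝔭 w hw1
  refine ⟨y, projX_ext 𝔭 fun m => ?_⟩
  rw [projX_d 𝔭 rfl, hy, hw2]

end Global


/-! ### Antisymmetric functions and functionals on tensor products. -/

section Flip

/-- A function on a product of sets with involutions that changes sign when one component is
inverted vanishes if it vanishes on multi-elements whose components all satisfy `A`. -/
lemma eq_zero_of_antisymmetric {ι : Type*} [Fintype ι] [DecidableEq ι] {E : ι → Type*}
    (o : ∀ j, E j → E j) (A : ∀ j, E j → Prop) (hA : ∀ j e, A j e ∨ A j (o j e))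
    (f : (∀ j, E j) → ℚ) (hf : ∀ e j, f e + f (Function.update e j (o j (e j))) = 0)
    (h0 : ∀ e, (∀ j, A j (e j)) → f e = 0) (e : ∀ j, E j) : f e = 0 := by
  -- The set `s` contains the components that may violate `A`; inverting one of them only changes
  -- the sign of `f`.
  have key : ∀ (s : Finset ι) (e : ∀ j, E j), (∀ j ∉ s, A j (e j)) → f e = 0 := by
    intro s
    induction s using Finset.induction_on with
    | empty => exact fun e he => h0 e fun j => he j (Finset.notMem_empty j)
    | insert k s hk ih =>
      intro e he
      rcases hA k (e k) with h | h
      · refine ih e fun j hj => ?_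
        by_cases hjk : j = k
        · subst hjk; exact h
        · exact he j (by simp [hjk, hj])
      · have := ih (Function.update e k (o k (e k))) fun j hj => by
          by_cases hjk : j = k
          · subst hjk; simpa using h
          · simpa [hjk] using he j (by simp [hjk, hj])
        have h2 := hf e k
        rwa [this, add_zero] at h2
  exact key Finset.univ e fun j hj => absurd (Finset.mem_univ j) hj

end Flip

section MultiFunctional

variable {r : ℕ}

/-- The functional on a tensor product given by a family of functionals. -/
def multiFunctional {V : Fin r → Type*} [∀ j, AddCommGroup (V j)] [∀ j, Module ℚ (V j)]
    (ℓ : ∀ j, V j →ₗ[ℚ] ℚ) : (⨂[ℚ] j, V j) →ₗ[ℚ] ℚ :=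
  PiTensorProduct.lift ((MultilinearMap.mkPiAlgebra ℚ (Fin r) ℚ).compLinearMap ℓ)

lemma multiFunctional_tprod {V : Fin r → Type*} [∀ j, AddCommGroup (V j)] [∀ j, Module ℚ (V j)]
    (ℓ : ∀ j, V j →ₗ[ℚ] ℚ) (x : ∀ j, V j) :
    multiFunctional ℓ (PiTensorProduct.tprod ℚ x) = ∏ j, ℓ j (x j) := by
  simp [multiFunctional]

lemma multiFunctional_coord {V κ : Fin r → Type*} [∀ j, AddCommGroup (V j)]
    [∀ j, Module ℚ (V j)] (b : ∀ j, Module.Basis (κ j) ℚ (V j)) (ε : ∀ j, κ j)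
    (x : ⨂[ℚ] j, V j) :
    multiFunctional (fun j => (b j).coord (ε j)) x = (Basis.piTensorProduct b).repr x ε := by
  have : multiFunctional (fun j => (b j).coord (ε j)) = (Basis.piTensorProduct b).coord ε := by
    ext y
    simp [multiFunctional_tprod]
  rw [this]; rfl

/-- Products of coordinate functionals are the coordinates of the tensor product basis, so they
separate elements. -/
lemma eq_of_multiFunctional_eq {V κ : Fin r → Type*} [∀ j, AddCommGroup (V j)]
    [∀ j, Module ℚ (V j)] (b : ∀ j, Module.Basis (κ j) ℚ (V j)) {x y : ⨂[ℚ] j, V j}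
    (h : ∀ ε : ∀ j, κ j, multiFunctional (fun j => (b j).coord (ε j)) x =
      multiFunctional (fun j => (b j).coord (ε j)) y) : x = y := by
  refine (Basis.piTensorProduct b).ext_elem fun ε => ?_
  rw [← multiFunctional_coord, ← multiFunctional_coord, h]

lemma multiFunctional_map {V W : Fin r → Type*} [∀ j, AddCommGroup (V j)] [∀ j, Module ℚ (V j)]
    [∀ j, AddCommGroup (W j)] [∀ j, Module ℚ (W j)]
    (ℓ : ∀ j, W j →ₗ[ℚ] ℚ) (f : ∀ j, V j →ₗ[ℚ] W j) (x : ⨂[ℚ] j, V j) :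
    multiFunctional ℓ (PiTensorProduct.map f x) = multiFunctional (fun j => ℓ j ∘ₗ f j) x := by
  have : multiFunctional ℓ ∘ₗ PiTensorProduct.map f = multiFunctional (fun j => ℓ j ∘ₗ f j) := by
    ext y
    simp [multiFunctional_tprod]
  rw [← this]; rfl

/-- A functional whose component in direction `p` is a sum is a sum of functionals. -/
lemma multiFunctional_eq_finsum {V : Fin r → Type*} [∀ j, AddCommGroup (V j)]
    [∀ j, Module ℚ (V j)] {I : Type*} [Finite I] (ℓ : ∀ j, V j →ₗ[ℚ] ℚ) (p : Fin r)
    (μ : I → ∀ j, V j →ₗ[ℚ] ℚ) (hp : ∀ y, ℓ p y = ∑ᶠ i, μ i p y)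
    (hq : ∀ i, ∀ q ≠ p, μ i q = ℓ q) (x : ⨂[ℚ] j, V j) :
    multiFunctional ℓ x = ∑ᶠ i, multiFunctional (μ i) x := by
  have := Fintype.ofFinite I
  simp only [finsum_eq_sum_of_fintype] at hp ⊢
  rw [← LinearMap.sum_apply]
  congr 1
  ext y
  simp only [LinearMap.compMultilinearMap_apply, LinearMap.sum_apply, multiFunctional_tprod]
  rw [← Finset.mul_prod_erase _ _ (Finset.mem_univ p), hp, Finset.sum_mul]
  refine Finset.sum_congr rfl fun i _ => ?_
  rw [← Finset.mul_prod_erase _ (fun j => μ i j (y j)) (Finset.mem_univ p)]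
  congr 1
  refine Finset.prod_congr rfl fun q hq' => ?_
  rw [hq i q (Finset.ne_of_mem_erase hq')]

lemma multiFunctional_add_eq_zero {V : Fin r → Type*} [∀ j, AddCommGroup (V j)]
    [∀ j, Module ℚ (V j)] {ℓ μ : ∀ j, V j →ₗ[ℚ] ℚ} (p : Fin r) (hp : μ p = -ℓ p)
    (hq : ∀ q ≠ p, μ q = ℓ q) (x : ⨂[ℚ] j, V j) :
    multiFunctional ℓ x + multiFunctional μ x = 0 := by
  have : multiFunctional ℓ + multiFunctional μ = 0 := by
    ext y
    simp only [LinearMap.compMultilinearMap_apply, LinearMap.add_apply, multiFunctional_tprod,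
      LinearMap.zero_apply]
    rw [← Finset.mul_prod_erase _ _ (Finset.mem_univ p),
      ← Finset.mul_prod_erase _ (fun j => μ j (y j)) (Finset.mem_univ p), hp,
      LinearMap.neg_apply, neg_mul, ← sub_eq_add_neg, sub_eq_zero]
    congr 1
    exact Finset.prod_congr rfl fun q hq' => by rw [hq q (Finset.ne_of_mem_erase hq')]
  rw [← LinearMap.add_apply, this, LinearMap.zero_apply]

end MultiFunctional

/-! ### Delta bases of the local complexes and their functionals. -/

section LocalBasis

variable (O K : Type u) [CommRing O] [IsDomain O] [IsDiscreteValuationRing O]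
  [Field K] [Algebra O K] [IsFractionRing O K]

variable {O K} in
/-- An orientation of the edges of the tree. -/
def Oriented (e : Edge O K) : Prop := WellOrderingRel e.fst e.snd

variable {O K} in
lemma oriented_or (e : Edge O K) : Oriented e ∨ Oriented e.symm := by
  rcases trichotomous_of WellOrderingRel e.fst e.snd with h | h | h
  · exact Or.inl h
  · exact absurd h e.adj.ne
  · exact Or.inr h

variable {O K} in
lemma not_oriented_symm {e : Edge O K} (h : Oriented e) : ¬ Oriented e.symm :=
  fun h' => asymm_of WellOrderingRel h h'

/-- The edge cochains are the functions on the oriented edges of an orientation. -/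
def edgeCochainsEquiv (m : ℕ) :
    edgeCochains O K m ≃ₗ[ℚ] ({e : EBall O K m // Oriented e.1} → ℚ) :=
  LinearEquiv.ofBijective
    (LinearMap.pi fun e => LinearMap.proj e.1 ∘ₗ (edgeCochains O K m).subtype) <| by
    classical
    constructor
    · rw [← LinearMap.ker_eq_bot, LinearMap.ker_eq_bot']
      intro c hc
      refine Subtype.ext (funext fun e => ?_)
      rcases oriented_or e.1 with h | h
      · exact congrFun hc ⟨e, h⟩
      · have h1 : c.1 e.opp = 0 := congrFun hc ⟨e.opp, h⟩
        have h2 := c.2 e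
        rwa [h1, add_zero] at h2
    · intro f
      let a : EBall O K m → ℚ := fun e => if h : Oriented e.1 then f ⟨e, h⟩ else 0
      refine ⟨⟨fun e => a e - a e.opp, fun e => ?_⟩, funext fun e => ?_⟩
      · change a e - a e.opp + (a e.opp - a e) = 0
        ring
      · change a e.1 - a e.1.opp = f e
        have h1 : a e.1 = f e := dif_pos e.2
        have h2 : a e.1.opp = 0 := dif_neg (not_oriented_symm e.2)
        rw [h1, h2, sub_zero]

variable [Finite (IsLocalRing.ResidueField O)]

/-- The index set of a basis of the local complex in degree `i`. -/
def LocalIdx (m : ℕ) : ℕ → Type u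
  | 0 => VBall O K m
  | 1 => {e : EBall O K (m + 1) // Oriented e.1}
  | _ + 2 => PEmpty

/-- The basis of delta functions of the local complex in degree `i`. -/
def localBasis (m : ℕ) : ∀ i, Module.Basis (LocalIdx O K m i) ℚ ((localComplex O K m).X i)
  | 0 => (Pi.basisFun ℚ (VBall O K m) : Module.Basis (VBall O K m) ℚ (VBall O K m → ℚ))
  | 1 => (Module.Basis.ofEquivFun (edgeCochainsEquiv O K (m + 1)) :
      Module.Basis {e : EBall O K (m + 1) // Oriented e.1} ℚ (edgeCochains O K (m + 1)))
  | _ + 2 => (Module.Basis.empty PUnit.{u + 1} : Module.Basis PEmpty.{u + 1} ℚ PUnit.{u + 1})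

lemma localBasis_coord_zero (m : ℕ) (v : VBall O K m) (f : VBall O K m → ℚ) :
    (localBasis O K m 0).coord v f = f v := by
  change (Pi.basisFun ℚ (VBall O K m)).coord v f = f v
  simp

lemma localBasis_coord_one (m : ℕ) (e : {e : EBall O K (m + 1) // Oriented e.1}) :
    (localBasis O K m 1).coord e = edgeValue e.1 := rfl

end LocalBasis


section LocalFunctionals

variable {O K : Type u} [CommRing O] [IsDomain O] [IsDiscreteValuationRing O]
  [Field K] [Algebra O K] [IsFractionRing O K] [Finite (IsLocalRing.ResidueField O)] {m : ℕ}

/-- The degrees in a multidegree equal `0` or `1` only propositionally. This lemma and the next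
three transport functionals along such equalities, with `idOrZero` as the cast. -/
lemma exists_functional_edge {i : ℕ} (hi : i = 1) (e : EBall O K (m + 1)) :
    ∃ l : (localComplex O K m).X i →ₗ[ℚ] ℚ,
      l ∘ₗ (idOrZero (localComplex O K m) 1 i).hom = edgeValue e := by
  subst hi
  exact ⟨edgeValue e, by rw [idOrZero_self]; rfl⟩

lemma exists_functional_vertex {i : ℕ} (hi : i = 0) (v : VBall O K m) :
    ∃ l : (localComplex O K m).X i →ₗ[ℚ] ℚ,
      ∀ y, l (((localComplex O K m).d 1 i).hom y) =
        ∑ᶠ e' : {e : Edge O K // e.fst = v.1}, edgeValue (v.out e') y := by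
  subst hi
  exact ⟨(LinearMap.proj v : (VBall O K m → ℚ) →ₗ[ℚ] ℚ), fun y => rfl⟩

lemma exists_edge_of_idx {i : ℕ} (hi : i = 1) (ε : LocalIdx O K m i) :
    ∃ e : EBall O K (m + 1),
      (localBasis O K m i).coord ε ∘ₗ (idOrZero (localComplex O K m) 1 i).hom = edgeValue e := by
  subst hi
  exact ⟨ε.1, by rw [idOrZero_self]; exact localBasis_coord_one O K m ε⟩

lemma exists_vertex_of_idx {i : ℕ} (hi : i = 0) (ε : LocalIdx O K m i) :
    ∃ v : VBall O K m, ∀ y, (localBasis O K m i).coord ε (((localComplex O K m).d 1 i).hom y) =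
        ∑ᶠ e' : {e : Edge O K // e.fst = v.1}, edgeValue (v.out e') y := by
  subst hi
  exact ⟨ε, fun y => localBasis_coord_zero O K m ε _⟩

lemma edgeValue_opp (e : EBall O K (m + 1)) : edgeValue e.opp = -edgeValue e :=
  LinearMap.ext fun y => eq_neg_of_add_eq_zero_right (edgeCochains O K (m + 1) |>.mem_carrier.1 y.2 e)

/-- Inclusion of balls, for edges. -/
def EBall.incl {k l : ℕ} (h : k ≤ l) (e : EBall O K k) : EBall O K l :=
  ⟨e.1, e.2.1.trans (by exact_mod_cast h), e.2.2.trans (by exact_mod_cast h)⟩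

lemma exists_edge_mem_ball (e : Edge O K) : ∃ m : ℕ, (tree O K).edist (base O K) e.fst ≤ m ∧
    (tree O K).edist (base O K) e.snd ≤ m := by
  obtain ⟨k, hk⟩ := exists_edist_base_eq e.fst
  obtain ⟨l, hl⟩ := exists_edist_base_eq e.snd
  exact ⟨max k l, hk.le.trans (by exact_mod_cast le_max_left _ _),
    hl.le.trans (by exact_mod_cast le_max_right _ _)⟩

end LocalFunctionals

/-! ### Cycles of top degree and harmonic cochains. -/

section Global

variable {F : Type u} [Field F] [NumberField F] {r : ℕ} (𝔭 : Fin r → HeightOneSpectrum (𝓞 F))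

/-- The multidegree `(1, …, 1)`. -/
def topDeg (r : ℕ) : MultiDeg r r := ⟨fun _ => 1, by simp⟩

lemma exists_two_le {n : ℕ} (hn : r ≤ n) {a : MultiDeg r n} (ha : a.1 ≠ fun _ => 1) :
    ∃ p, 2 ≤ a.1 p := by
  by_contra! h
  have h1 : ∀ p ∈ Finset.univ, a.1 p ≤ 1 := fun p _ => Nat.lt_succ_iff.1 (h p)
  have h2 : ∑ p, a.1 p ≤ ∑ _p : Fin r, 1 := Finset.sum_le_sum h1
  have h3 : ∑ p, a.1 p = ∑ _p : Fin r, 1 := le_antisymm h2 (by rw [a.2]; simpa using hn)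
  exact ha (funext fun p => (Finset.sum_eq_sum_iff_of_le h1).1 h3 p (Finset.mem_univ p))

lemma component_eq_zero {m : ℕ} (x : tensorX (localFamily 𝔭 m) r) {a : MultiDeg r r}
    (ha : a ≠ topDeg r) : x a = 0 := by
  obtain ⟨p, hp⟩ := exists_two_le le_rfl (a := a) fun h => ha (Subtype.ext h)
  exact tensorX_component_eq_zero (subsingleton_localFamily 𝔭 m) x hp

lemma tensorX_succ_eq_zero {m : ℕ} (x : tensorX (localFamily 𝔭 m) (r + 1)) : x = 0 := by
  funext a
  obtain ⟨p, hp⟩ := exists_two_le r.le_succ (a := a) fun h => by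
    have := a.2
    rw [h] at this
    simp at this
  exact tensorX_component_eq_zero (subsingleton_localFamily 𝔭 m) x hp

/-- An element of top degree is determined by its values at multiedges. -/
lemma evalTop_ext {m : ℕ} {x y : tensorX (localFamily 𝔭 m) r}
    (h : ∀ e, evalTop 𝔭 m e x = evalTop 𝔭 m e y) : x = y := by
  funext a
  by_cases ha : a = topDeg r
  · subst ha
    exact eq_of_multiFunctional_eq (fun j => localBasis _ _ m 1) fun ε => h fun j => (ε j).1
  · rw [component_eq_zero 𝔭 x ha, component_eq_zero 𝔭 y ha]

lemma evalTop_update_opp {m : ℕ} (e : ∀ j, PEBall (𝔭 j) (m + 1)) (j : Fin r)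
    (x : tensorX (localFamily 𝔭 m) r) :
    evalTop 𝔭 m e x + evalTop 𝔭 m (Function.update e j (e j).opp) x = 0 := by
  refine multiFunctional_add_eq_zero j ?_ (fun q hq => ?_) _
  · rw [Function.update_self, edgeValue_opp]
  · rw [Function.update_of_ne hq]

/-- Finiteness of the balls lets the values of `g` on positively oriented multiedges serve as
coordinates in the tensor basis; antisymmetry determines the other values. -/
lemma exists_evalTop_eq (m : ℕ) (g : (∀ j, PEBall (𝔭 j) (m + 1)) → ℚ)
    (hg : ∀ e j, g e + g (Function.update e j (e j).opp) = 0) :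
    ∃ x : tensorX (localFamily 𝔭 m) r, ∀ e, evalTop 𝔭 m e x = g e := by
  classical
  let b := fun j => localBasis ((𝔭 j).adicCompletionIntegers F) ((𝔭 j).adicCompletion F) m 1
  have hfin : Finite (∀ j, LocalIdx ((𝔭 j).adicCompletionIntegers F)
      ((𝔭 j).adicCompletion F) m 1) := by
    have : ∀ j, Finite (LocalIdx ((𝔭 j).adicCompletionIntegers F)
      ((𝔭 j).adicCompletion F) m 1) := fun j => inferInstanceAs
        (Finite {e : PEBall (𝔭 j) (m + 1) // Oriented e.1})
    infer_instance
  let y : ⨂[ℚ] j, (localFamily 𝔭 m j).X 1 := (Basis.piTensorProduct b).repr.symm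
    (Finsupp.equivFunOnFinite.symm
      fun ε : ∀ j, LocalIdx ((𝔭 j).adicCompletionIntegers F) ((𝔭 j).adicCompletion F) m 1 =>
        g fun j => (ε j).1)
  have hy : ∀ ε : ∀ j, LocalIdx ((𝔭 j).adicCompletionIntegers F) ((𝔭 j).adicCompletion F) m 1,
      multiFunctional (fun j => (b j).coord (ε j)) y = g fun j => (ε j).1 := by
    intro ε
    rw [multiFunctional_coord]
    simp [y]
  obtain ⟨x, hx⟩ : ∃ x : tensorX (localFamily 𝔭 m) r, x (topDeg r) = y :=
    ⟨Pi.single (M := fun a : MultiDeg r r => ⨂[ℚ] j, (localFamily 𝔭 m j).X (a.1 j)) (topDeg r) y,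
      Pi.single_eq_same _ _⟩
  refine ⟨x, fun e => sub_eq_zero.1 ?_⟩
  refine eq_zero_of_antisymmetric (fun j => EBall.opp) (fun j e => Oriented e.1)
    (fun j e => oriented_or e.1) (fun e => evalTop 𝔭 m e x - g e) ?_ ?_ e
  · intro e j
    linear_combination evalTop_update_opp 𝔭 e j x - hg e j
  · intro e he
    exact sub_eq_zero.2 ((congrArg (multiFunctional fun j => edgeValue (e j)) hx).trans
      (hy fun j => ⟨e j, he j⟩))

lemma evalTop_resX {m : ℕ} (e : ∀ j, PEBall (𝔭 j) (m + 1))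
    (x : tensorX (localFamily 𝔭 (m + 1)) r) :
    evalTop 𝔭 m e (resX 𝔭 m r x) =
      evalTop 𝔭 (m + 1) (fun j => (e j).incl (Nat.le_succ (m + 1))) x := by
  exact multiFunctional_map _ (fun j => ((localRes ((𝔭 j).adicCompletionIntegers F)
    ((𝔭 j).adicCompletion F) m).f 1).hom) (x (topDeg r))

lemma evalTop_projX (x : (limitComplex 𝔭).X r) {m m' : ℕ} (h : m ≤ m')
    (e : ∀ j, PEBall (𝔭 j) (m + 1)) (e' : ∀ j, PEBall (𝔭 j) (m' + 1))
    (he : ∀ j, (e j).1 = (e' j).1) :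
    evalTop 𝔭 m e (projX 𝔭 m r x) = evalTop 𝔭 m' e' (projX 𝔭 m' r x) := by
  induction m', h using Nat.le_induction with
  | base => rw [funext fun j => Subtype.ext (he j)]
  | succ n hn ih =>
    rw [ih (fun j => (e j).incl (Nat.succ_le_succ hn)) fun j => rfl, ← resX_projX, evalTop_resX]
    congr 1
    exact congrArg _ (funext fun j => Subtype.ext (he j))

/-- The functional of a partial differential in direction `p` is the sum over the edges with a given
source in the `p`-th component. -/
lemma multiFunctional_partialD {m n : ℕ} (h : n + 1 = r) (x : tensorX (localFamily 𝔭 m) r)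
    (a : MultiDeg r n) (p : Fin r) (hp : a.succ h p = topDeg r)
    (l : ∀ q, (localFamily 𝔭 m q).X (a.1 q) →ₗ[ℚ] ℚ) (e : ∀ j, PEBall (𝔭 j) (m + 1))
    (v : VBall ((𝔭 p).adicCompletionIntegers F) ((𝔭 p).adicCompletion F) m)
    (hl : ∀ q ≠ p, l q ∘ₗ (idOrZero (localFamily 𝔭 m q) 1 (a.1 q)).hom = edgeValue (e q))
    (hv : ∀ y, l p (((localFamily 𝔭 m p).d 1 (a.1 p)).hom y) =
      ∑ᶠ e' : {e : PEdge (𝔭 p) // e.fst = v.1}, edgeValue (v.out e') y) :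
    multiFunctional l (PiTensorProduct.map (fun q =>
      (partialFactor (localFamily 𝔭 m) p q ((a.succ h p).1 q) (a.1 q)).hom) (x (a.succ h p))) =
    ∑ᶠ e' : {e : PEdge (𝔭 p) // e.fst = v.1},
      evalTop 𝔭 m (Function.update e p (v.out e')) x := by
  -- After this substitution the source component literally has multidegree `(1, …, 1)`.
  generalize a.succ h p = c at hp
  subst hp
  rw [multiFunctional_map]
  refine multiFunctional_eq_finsum (V := fun j => (localFamily 𝔭 m j).X 1) _ p
    (fun (e' : {e : PEdge (𝔭 p) // e.fst = v.1}) j =>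
      edgeValue (Function.update e p (v.out e') j)) (fun y => ?_) (fun e' q hq => ?_) _
  · simp only [Function.update_self]
    rw [← hv y]
    simp [partialFactor, topDeg]
    rfl
  · rw [Function.update_of_ne hq, ← hl q hq]
    simp [partialFactor, topDeg, hq]
    rfl

lemma succ_eq_topDeg {n : ℕ} (h : n + 1 = r) {a : MultiDeg r n} {p : Fin r}
    (hp : a.succ h p = topDeg r) (q : Fin r) : a.1 q = if q = p then 0 else 1 := by
  have h1 : a.1 q + (Pi.single p 1 : Fin r → ℕ) q = 1 := congrFun (congrArg Subtype.val hp) q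
  by_cases hq : q = p
  · subst hq
    simpa using h1
  · simpa [hq] using h1

/-- The sum is a functional applied to the component of `d x` in the multidegree with `0` at `p` and
`1` elsewhere: evaluation at `v` in direction `p` and at the edges `e q` in the others. -/
lemma finsum_evalTop_eq_zero {m : ℕ} (x : tensorX (localFamily 𝔭 m) r)
    (hx : ∀ n (h : n + 1 = r), tensorD (localFamily 𝔭 m) h x = 0)
    (e : ∀ j, PEBall (𝔭 j) (m + 1)) (p : Fin r)
    (v : VBall ((𝔭 p).adicCompletionIntegers F) ((𝔭 p).adicCompletion F) m) :
    ∑ᶠ e' : {e : PEdge (𝔭 p) // e.fst = v.1},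
      evalTop 𝔭 m (Function.update e p (v.out e')) x = 0 := by
  obtain ⟨n, h⟩ : ∃ n, n + 1 = r := ⟨r - 1, Nat.succ_pred_eq_of_pos p.pos⟩
  have hsum : (fun q => if q = p then 0 else 1 : Fin r → ℕ) + Pi.single p 1 = fun _ => 1 := by
    funext q
    by_cases hq : q = p <;> simp [hq]
  let a : MultiDeg r n := ⟨fun q => if q = p then 0 else 1, by
    have h1 := sum_add_single (fun q => if q = p then 0 else 1 : Fin r → ℕ) p
    rw [hsum] at h1
    simp only [Finset.sum_const, Finset.card_univ, Fintype.card_fin, smul_eq_mul, mul_one] at h1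
    lia⟩
  have ha : a.succ h p = topDeg r := Subtype.ext hsum
  have hex : ∀ q, ∃ l : (localFamily 𝔭 m q).X (a.1 q) →ₗ[ℚ] ℚ,
      (q ≠ p → l ∘ₗ (idOrZero (localFamily 𝔭 m q) 1 (a.1 q)).hom = edgeValue (e q)) := by
    intro q
    by_cases hq : q = p
    · exact ⟨0, fun h => absurd hq h⟩
    · obtain ⟨l, hl⟩ := exists_functional_edge (m := m) (i := a.1 q) (if_neg hq) (e q)
      exact ⟨l, fun _ => hl⟩
  choose l hl using hex
  obtain ⟨l', hl'⟩ := exists_functional_vertex (m := m) (i := a.1 p) (if_pos rfl) v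
  rw [← multiFunctional_partialD 𝔭 h x a p ha (Function.update l p l') e v
    (fun q hq => by rw [Function.update_of_ne hq]; exact hl q hq)
    (fun y => by rw [Function.update_self]; exact hl' y)]
  have h0 : tensorD (localFamily 𝔭 m) h x a = 0 := by rw [hx]; rfl
  simp only [tensorD, LinearMap.pi_apply, LinearMap.sum_apply] at h0
  -- Raising the entry at `q ≠ p` gives a multidegree other than `(1, …, 1)`, where `x` vanishes.
  rw [Finset.sum_eq_single p (fun q _ hq => ?_) (by simp)] at h0
  · simp only [LinearMap.smul_apply, LinearMap.comp_apply, LinearMap.proj_apply] at h0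
    rw [(smul_eq_zero.1 h0).resolve_left (by simp), map_zero]
  · simp only [LinearMap.smul_apply, LinearMap.comp_apply, LinearMap.proj_apply]
    rw [component_eq_zero 𝔭 x, map_zero, smul_zero]
    intro hq'
    have h1 := succ_eq_topDeg h hq' q
    simp [a, hq] at h1

lemma tensorD_eq_zero {m : ℕ} (x : tensorX (localFamily 𝔭 m) r)
    (hx : ∀ (e : ∀ j, PEBall (𝔭 j) (m + 1)) (p : Fin r)
      (v : VBall ((𝔭 p).adicCompletionIntegers F) ((𝔭 p).adicCompletion F) m),
      ∑ᶠ e' : {e : PEdge (𝔭 p) // e.fst = v.1},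
        evalTop 𝔭 m (Function.update e p (v.out e')) x = 0)
    {n : ℕ} (h : n + 1 = r) : tensorD (localFamily 𝔭 m) h x = 0 := by
  funext a
  simp only [tensorD, LinearMap.pi_apply, LinearMap.sum_apply, LinearMap.smul_apply,
    LinearMap.comp_apply, LinearMap.proj_apply]
  refine Finset.sum_eq_zero fun p _ => ?_
  by_cases ha : a.succ h p = topDeg r
  · refine smul_eq_zero_of_right _ ?_
    refine eq_of_multiFunctional_eq (fun j => localBasis _ _ m (a.1 j)) fun ε => ?_
    obtain ⟨v, hv⟩ := exists_vertex_of_idx (by simp [succ_eq_topDeg h ha]) (ε p)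
    have hex : ∀ q, ∃ e : PEBall (𝔭 q) (m + 1), q ≠ p →
        (localBasis _ _ m (a.1 q)).coord (ε q) ∘ₗ
          (idOrZero (localFamily 𝔭 m q) 1 (a.1 q)).hom = edgeValue e := by
      intro q
      by_cases hq : q = p
      · subst hq
        obtain ⟨f, hf, -⟩ := exists_child v.1
        exact ⟨v.out ⟨f, hf⟩, fun h => absurd rfl h⟩
      · obtain ⟨e, he⟩ := exists_edge_of_idx (by simp [succ_eq_topDeg h ha, hq]) (ε q)
        exact ⟨e, fun _ => he⟩
    choose e he using hex
    rw [multiFunctional_partialD 𝔭 h x a p ha _ e v he hv, hx, map_zero]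
  · rw [component_eq_zero 𝔭 x ha, map_zero, smul_zero]

lemma exists_level (e : ∀ j, PEdge (𝔭 j)) :
    ∃ (m : ℕ) (ε : ∀ j, PEBall (𝔭 j) (m + 1)), ∀ j, (ε j).1 = e j := by
  choose k hk using fun j => exists_edge_mem_ball (e j)
  exact ⟨Finset.univ.sup k, fun j => ⟨e j,
    (hk j).1.trans (by exact_mod_cast (Finset.le_sup (Finset.mem_univ j)).trans (Nat.le_succ _)),
    (hk j).2.trans (by exact_mod_cast (Finset.le_sup (Finset.mem_univ j)).trans (Nat.le_succ _))⟩,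
    fun j => rfl⟩

/-- The function on multiedges given by an element of top degree of the limit complex. -/
def evalLimit : (limitComplex 𝔭).X r →ₗ[ℚ] ((∀ j, PEdge (𝔭 j)) → ℚ) :=
  LinearMap.pi fun e => evalTop 𝔭 (exists_level 𝔭 e).choose (exists_level 𝔭 e).choose_spec.choose ∘ₗ
    projX 𝔭 (exists_level 𝔭 e).choose r

/-- Values at different levels agree by compatibility with restriction, so the level chosen in
`evalLimit` is immaterial. -/
lemma evalLimit_apply (x : (limitComplex 𝔭).X r) {m : ℕ} {e : ∀ j, PEdge (𝔭 j)}
    (ε : ∀ j, PEBall (𝔭 j) (m + 1)) (hε : ∀ j, (ε j).1 = e j) :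
    evalLimit 𝔭 x e = evalTop 𝔭 m ε (projX 𝔭 m r x) := by
  have h := (exists_level 𝔭 e).choose_spec.choose_spec
  change evalTop 𝔭 _ (exists_level 𝔭 e).choose_spec.choose (projX 𝔭 _ r x) = _
  rcases le_total (exists_level 𝔭 e).choose m with hm | hm
  · exact evalTop_projX 𝔭 x hm _ _ fun j => (h j).trans (hε j).symm
  · exact (evalTop_projX 𝔭 x hm _ _ fun j => (hε j).trans (h j).symm).symm

lemma evalLimit_mem (x : (limitComplex 𝔭).X r)
    (hx : ∀ n, ((limitComplex 𝔭).d r n).hom x = 0) : evalLimit 𝔭 x ∈ harmonicCochains 𝔭 := by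
  rw [limit_d_eq_zero_iff] at hx
  refine ⟨fun e j => ?_, fun e j v => ?_⟩
  · obtain ⟨m, ε, hε⟩ := exists_level 𝔭 e
    rw [evalLimit_apply 𝔭 x ε hε, evalLimit_apply 𝔭 x (Function.update ε j (ε j).opp)]
    · exact evalTop_update_opp 𝔭 ε j _
    · intro i
      by_cases hi : i = j
      · subst hi; simp [EBall.opp, hε]
      · simp [hi, hε]
  · obtain ⟨m, ε, hε⟩ := exists_level 𝔭 e
    obtain ⟨k, hk⟩ := exists_edist_base_eq v
    -- The level must be large enough for the multiedge and also for `v`, so that all edges leaving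
    -- `v` are visible.
    let v' : VBall ((𝔭 j).adicCompletionIntegers F) ((𝔭 j).adicCompletion F) (max m k) :=
      ⟨v, hk.le.trans (by exact_mod_cast le_max_right _ _)⟩
    let ε' : ∀ j, PEBall (𝔭 j) (max m k + 1) := fun j =>
      (ε j).incl (Nat.succ_le_succ (le_max_left _ _))
    rw [← finsum_evalTop_eq_zero 𝔭 (projX 𝔭 (max m k) r x) (hx _) ε' j v']
    refine finsum_congr fun e' => evalLimit_apply 𝔭 x _ fun i => ?_
    by_cases hi : i = j
    · subst hi; simp [VBall.out]
    · rw [Function.update_of_ne hi, Function.update_of_ne hi]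
      exact hε i

lemma evalLimit_injective {x : (limitComplex 𝔭).X r} (hx : evalLimit 𝔭 x = 0) : x = 0 := by
  refine projX_ext 𝔭 fun m => evalTop_ext 𝔭 fun e => ?_
  rw [← evalLimit_apply 𝔭 x e fun j => rfl, hx, map_zero]
  exact (map_zero (evalTop 𝔭 m e)).symm

/-- The restrictions of `c` to the balls come from unique tensors; uniqueness makes these
compatible, and harmonicity makes them cycles. -/
lemma exists_evalLimit_eq {c : (∀ j, PEdge (𝔭 j)) → ℚ} (hc : c ∈ harmonicCochains 𝔭) :
    ∃ x : (limitComplex 𝔭).X r, (∀ n, ((limitComplex 𝔭).d r n).hom x = 0) ∧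
      evalLimit 𝔭 x = c := by
  have hupd : ∀ {m : ℕ} (e : ∀ j, PEBall (𝔭 j) (m + 1)) (j : Fin r) (f : PEBall (𝔭 j) (m + 1)),
      (fun i => (Function.update e j f i).1) = Function.update (fun i => (e i).1) j f.1 := by
    intro m e j f
    funext i
    by_cases hi : i = j
    · subst hi; simp
    · simp [hi]
  choose w hw using fun m => exists_evalTop_eq 𝔭 m (fun e => c fun j => (e j).1) fun e j => by
    rw [hupd]
    exact hc.1 _ j
  obtain ⟨x, hx⟩ := exists_projX_eq 𝔭 w fun m => evalTop_ext 𝔭 fun e => by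
    rw [evalTop_resX, hw, hw]; rfl
  refine ⟨x, (limit_d_eq_zero_iff 𝔭 x).2 fun m n h => tensorD_eq_zero 𝔭 _ (fun e p v => ?_) h, ?_⟩
  · rw [← hc.2 (fun j => (e j).1) p v.1]
    refine finsum_congr fun e' => ?_
    rw [hx, hw, hupd]
    rfl
  · funext e
    obtain ⟨m, ε, hε⟩ := exists_level 𝔭 e
    rw [evalLimit_apply 𝔭 x ε hε, hx, hw, funext hε]

lemma d_iCycles_apply (z : (limitComplex 𝔭).cycles r) (n : ℕ) :
    ((limitComplex 𝔭).d r n).hom (((limitComplex 𝔭).iCycles r).hom z) = 0 :=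
  LinearMap.congr_fun (congrArg ModuleCat.Hom.hom ((limitComplex 𝔭).iCycles_d r n)) z

/-- The cycles of top degree of the limit complex are the harmonic cochains. -/
def cyclesEquiv : (limitComplex 𝔭).cycles r ≃ₗ[ℚ] harmonicCochains 𝔭 :=
  LinearEquiv.ofBijective ((evalLimit 𝔭 ∘ₗ ((limitComplex 𝔭).iCycles r).hom).codRestrict
    (harmonicCochains 𝔭) fun z => evalLimit_mem 𝔭 _ (d_iCycles_apply 𝔭 z)) <| by
    constructor
    · rw [← LinearMap.ker_eq_bot, LinearMap.ker_eq_bot']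
      intro z hz
      have h1 := evalLimit_injective 𝔭 (congrArg Subtype.val hz)
      exact (ModuleCat.mono_iff_injective _).1 inferInstance
        (h1.trans (map_zero ((limitComplex 𝔭).iCycles r).hom).symm)
    · rintro ⟨c, hc⟩
      obtain ⟨x, hx, rfl⟩ := exists_evalLimit_eq 𝔭 hc
      obtain ⟨z, rfl⟩ := exists_cycle x hx
      exact ⟨z, rfl⟩

lemma limit_d_succ_eq_zero : (limitComplex 𝔭).d (r + 1) r = 0 := by
  ext x
  have : x = 0 := projX_ext 𝔭 fun m => by
    rw [tensorX_succ_eq_zero 𝔭 (projX 𝔭 m (r + 1) x), map_zero]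
  rw [this, map_zero, map_zero]

end Global

end BruhatTits

end

open BruhatTits

theorem proposition3p4 {F : Type*} [Field F] [NumberField F] {r : ℕ}
    (𝔭 : Fin r → HeightOneSpectrum (𝓞 F)) (h𝔭 : Function.Injective 𝔭) :
    (∀ i : ℕ, i ≠ r → IsZero ((limitComplex 𝔭).homology i)) ∧
    ∃ Φ : (limitComplex 𝔭).homology r ≃ₗ[ℚ] harmonicCochains 𝔭,
      ∀ (z : (limitComplex 𝔭).cycles r) (m : ℕ) (e : ∀ j, PEBall (𝔭 j) (m + 1)),
        (Φ ((limitComplex 𝔭).homologyπ r z)).1 (fun j => (e j).1) =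
          evalTop 𝔭 m e ((limitProj 𝔭 m).f r ((limitComplex 𝔭).iCycles r z)) := by
  refine ⟨fun i hi => isZero_homology_limitComplex 𝔭 hi, ?_⟩
  -- There are no boundaries in degree `r`, so the homology is the space of cycles.
  have := (limitComplex 𝔭).isIso_homologyπ (r + 1) r (by simp) (limit_d_succ_eq_zero 𝔭)
  let π := (asIso ((limitComplex 𝔭).homologyπ r)).toLinearEquiv
  refine ⟨π.symm ≪≫ₗ cyclesEquiv 𝔭, fun z m e => ?_⟩
  have hz : π.symm ((limitComplex 𝔭).homologyπ r z) = z := π.symm_apply_apply z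
  rw [LinearEquiv.trans_apply, hz]
  exact evalLimit_apply 𝔭 _ e fun j => rfl
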